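/- Let $q\in\mathbb{C}\setminus\{0\}$ be not a root of unity, fix a square root $q^{1/2}$, and put $\hat q=q-q^{-1}$, $[2]=q+q^{-1}$. For $i,j,k,l\in\{1,2\}$ let $$\hat R^{ij}_{kl}=\delta_{il}\delta_{jk}\,q^{\delta_{ij}-1/2}+q^{-1/2}\hat q\,\delta_{i1}\delta_{k1}\delta_{j2}\delta_{l2},\qquad \check C^{ij}=q^{-1/2}\delta_{i1}\delta_{j2}-q^{1/2}\delta_{i2}\delta_{j1},\qquad \hat C_{ij}=-\check C^{ij},$$ and let $\hat R^{-1}$ be the inverse matrix of $\hat R$ (repeated indices are summed). Let $\mathcal A=\mathcal O(\mathrm{SL}_q(2))$ be the algebra with generators $u^i_j$ and relations $\hat R^{ij}_{kl}u^k_mu^l_n=u^i_ku^j_l\hat R^{kl}_{mn}$, $u^1_1u^2_2-q\,u^1_2u^2_1=1$, with coproduct $\Delta(u^i_j)=u^i_k\otimes u^k_j$. Let $\nu\in\{1,-1\}$ and let $\Gamma$ be the bicovariant $\mathcal A$-bimodule of one-forms of the $4D_\pm$-calculus ($\nu=\pm1$): it is free as a left $\mathcal A$-module with basis $\theta_{ij}$,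 $i,j=1,2$, and $$\theta_{ij}u^k_l=\nu\,\hat R^{mr}_{it}(\hat R^{-1})^{tp}_{jl}\,u^k_m\theta_{rp},\qquad \Delta_L(\theta_{ij})=1\otimes\theta_{ij},\qquad \Delta_R(\theta_{ij})=\theta_{kl}\otimes u^k_iu^l_j .$$ Let $\sigma$ be its canonical braiding, i.e. the bimodule automorphism of $\Gamma\otimes_{\mathcal A}\Gamma$ with $\sigma(\rho\otimes\rho')=\rho'\otimes\rho$ for $\rho$ left-invariant and $\rho'$ right-invariant. Let $g:\Gamma\otimes_{\mathcal A}\Gamma\to\mathcal A$ be a bicovariant $\sigma$-metric, i.e. a non-degenerate homomorphism of bicovariant $\mathcal A$-bimodules with $g\sigma=g$ and $g_{12}\sigma_{23}^{\pm1}\sigma_{12}^{\pm1}=g_{23}$. (No compatibility with an involution is required.) The quantum Clifford algebra $\mathrm{Cl}(\Gamma,\sigma,g)$ is the quotient of the tensor algebra of $\Gamma$ over $\mathcal A$ by the two-sided ideal generated by the elements $\rho_2-g(\rho_2)$, $\rho_2\in\ker(\mathrm{id}-\sigma)\subseteq\Gamma\otimes_{\mathcal A}\Gamma$. It carries the left coaction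 of $\mathcal A$ that is the algebra map $\Delta_L$ with $a\mapsto\Delta(a)$ for $a\in\mathcal A$ and $\theta_{ij}\mapsto1\otimes\theta_{ij}$; a left or two-sided ideal $J$ is called left-covariant if $\Delta_L(J)\subseteq\mathcal A\otimes J$. Then there is a constant $c_1\in\mathbb{C}\setminus\{0\}$ with $g(\theta_{ij}\otimes\theta_{kl})=-q^{1/2}c_1\hat C_{im}\hat C_{nl}(\hat R^{-1})^{mn}_{jk}$ for all $i,j,k,l$, and, with this $c_1$: 1. $\mathrm{Cl}(\Gamma,\sigma,g)$ is a simple left-covariant algebra: it is nonzero, and its only left-covariant two-sided ideals are $0$ and $\mathrm{Cl}(\Gamma,\sigma,g)$. 2. The elements $$\psi^+_1=\frac{q}{[2]c_1}\theta_{11}\theta_{12}\theta_{21}\theta_{22},\quad \psi^+_2=\theta_{21}\theta_{22},\quad \psi^-_1=\theta_{11}\theta_{21}\theta_{22},\quad \psi^-_2=q\,\theta_{12}\theta_{21}\theta_{22}$$ generate a minimal left-covariant left ideal $\mathcal S_0$ of $\mathrm{Cl}(\Gamma,\sigma,g)$: the left ideal $\mathcal S_0$ generated by them is left-covariant, nonzero,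 and minimal among the nonzero left-covariant left ideals; moreover $\mathcal S_0=\mathcal A\psi^+_1+\mathcal A\psi^+_2+\mathcal A\psi^-_1+\mathcal A\psi^-_2$. -/

import Mathlib

open scoped TensorProduct

noncomputable section

namespace QuantumClifford

/-! ## Bicovariant bimodules, their tensor algebras and Clifford algebras

A bicovariant bimodule over a bialgebra `A` that is free as a left module on a finite family
`θ i` (`i : I`) of left-invariant elements is given by an algebra map `f : A → Mat_I(ℂ)`
and a matrix `v` over `A`:
`θ i · a = ∑ j, a₍₁₎ f(a₍₂₎) i j · θ j`, `Δ_L (θ i) = 1 ⊗ θ i`, `Δ_R (θ i) = ∑ k, θ k ⊗ v k i`.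
The bimodule `Γ` itself is the left module `I → A` (the coordinates with respect to `θ`), and
`Γ ⊗_A Γ` is the free left module `I × I → A` (the coordinates with respect to `θ i ⊗ θ j`). -/

section Bimodule

variable {A : Type} [Ring A] [Bialgebra ℂ A] {I : Type} [Fintype I] [DecidableEq I]

/-- The linear map `a ↦ a₍₁₎ φ(a₍₂₎)`. -/
def convRight (φ : A →ₗ[ℂ] ℂ) : A →ₗ[ℂ] A :=
  (TensorProduct.rid ℂ A).toLinearMap ∘ₗ φ.lTensor A ∘ₗ Coalgebra.comul

/-- The functional `a ↦ f(a) i j`. -/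
def entry (f : A →ₐ[ℂ] Matrix I I ℂ) (i j : I) : A →ₗ[ℂ] ℂ :=
  Matrix.entryLinearMap ℂ ℂ i j ∘ₗ f.toLinearMap

/-- The linear map `a ↦ a₍₁₎ f(a₍₂₎) i j`, so that `θ i · a = ∑ j, (move f i j a) θ j`. -/
def move (f : A →ₐ[ℂ] Matrix I I ℂ) (i j : I) : A →ₗ[ℂ] A := convRight (entry f i j)

theorem comul_convRight (φ : A →ₗ[ℂ] ℂ) (a : A) :
    Coalgebra.comul (R := ℂ) (convRight φ a) =
      (convRight φ).lTensor A (Coalgebra.comul (R := ℂ) a) := by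
  have h := Coalgebra.coassoc_apply (R := ℂ) a
  have h2 := congrArg (fun x => TensorProduct.map LinearMap.id
    ((TensorProduct.rid ℂ A).toLinearMap ∘ₗ φ.lTensor A) x) h
  have e1 : ∀ x : A ⊗[ℂ] A, TensorProduct.map (LinearMap.id (R := ℂ) (M := A))
      ((TensorProduct.rid ℂ A).toLinearMap ∘ₗ φ.lTensor A)
      (TensorProduct.assoc ℂ A A A (Coalgebra.comul.rTensor A x)) =
      Coalgebra.comul (R := ℂ) ((TensorProduct.rid ℂ A) (φ.lTensor A x)) := by
    intro x
    induction x with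
    | zero => simp
    | add x y hx hy => simp only [map_add, hx, hy]
    | tmul x y =>
      simp only [LinearMap.rTensor_tmul, LinearMap.lTensor_tmul, TensorProduct.rid_tmul, map_smul]
      generalize Coalgebra.comul (R := ℂ) x = z
      induction z with
      | zero => simp
      | add z w hz hw => simp only [TensorProduct.add_tmul, map_add, hz, hw, smul_add]
      | tmul z w => simp
  have e2 : ∀ x : A ⊗[ℂ] A, TensorProduct.map (LinearMap.id (R := ℂ) (M := A))
      ((TensorProduct.rid ℂ A).toLinearMap ∘ₗ φ.lTensor A)
      (Coalgebra.comul.lTensor A x) = (convRight φ).lTensor A x := by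
    intro x
    induction x with
    | zero => simp
    | add x y hx hy => simp only [map_add, hx, hy]
    | tmul x y => simp [convRight]
  simp only [e1, e2] at h2
  exact h2

/-- The left coaction `a θ_p ↦ a₍₁₎ ⊗ a₍₂₎ θ_p` of the free left module on left-invariant
elements `θ_p`, `p : J`. -/
def leftCoaction (A : Type) [Ring A] [Bialgebra ℂ A] (J : Type) [Fintype J] [DecidableEq J] :
    (J → A) →ₗ[ℂ] A ⊗[ℂ] (J → A) :=
  ∑ p, (LinearMap.single ℂ (fun _ : J => A) p).lTensor A ∘ₗ Coalgebra.comul ∘ₗ LinearMap.proj p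

/-- Right multiplication on `Γ`. -/
def rmul (f : A →ₐ[ℂ] Matrix I I ℂ) (x : I → A) (a : A) : I → A :=
  fun j => ∑ i, x i * move f i j a

/-- The canonical balanced map `Γ × Γ → Γ ⊗_A Γ`, `(x, y) ↦ x ⊗ y`. -/
def tmul (f : A →ₐ[ℂ] Matrix I I ℂ) (x y : I → A) : I × I → A :=
  fun p => rmul f x (y p.2) p.1

/-- Right multiplication on `Γ ⊗_A Γ`. -/
def rmul₂ (f : A →ₐ[ℂ] Matrix I I ℂ) (z : I × I → A) (a : A) : I × I → A :=
  fun p => ∑ q : I × I, z q * move f q.1 p.1 (move f q.2 p.2 a)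

/-- The right coaction of `Γ ⊗_A Γ`:
`a θ i ⊗ θ j ↦ ∑ k l, a₍₁₎ θ k ⊗ θ l ⊗ a₍₂₎ v k i v l j`. -/
def rightCoaction₂ (v : I → I → A) (z : I × I → A) : (I × I → A) ⊗[ℂ] A :=
  ∑ p : I × I, ∑ r : I × I, (LinearMap.single ℂ (fun _ : I × I => A) r).rTensor A
    (Coalgebra.comul (R := ℂ) (z p) * ((1 : A) ⊗ₜ[ℂ] (v r.1 p.1 * v r.2 p.2)))

/-- The canonical braiding of the bicovariant bimodule: the left `A`-linear map with
`σ(θ m ⊗ θ r) = ∑ i k, f(v i r) m k · θ i ⊗ θ k`. It is the bimodule map with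
`σ(ρ ⊗ ρ') = ρ' ⊗ ρ` for left-invariant `ρ` and right-invariant `ρ'`. -/
def braiding (f : A →ₐ[ℂ] Matrix I I ℂ) (v : I → I → A) : (I × I → A) →ₗ[A] (I × I → A) where
  toFun z := fun p => ∑ q : I × I, entry f q.1 p.2 (v p.1 q.2) • z q
  map_add' x y := by
    funext p; simp [Finset.sum_add_distrib]
  map_smul' a x := by
    funext p; simp [Finset.mul_sum]

/-- The relations of the tensor algebra of `Γ` over `A`: those of the algebra `A` and
the right multiplication of `Γ`. -/
inductive TensorRel (f : A →ₐ[ℂ] Matrix I I ℂ) :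
    FreeAlgebra ℂ (A ⊕ I) → FreeAlgebra ℂ (A ⊕ I) → Prop
  | algebraMap (c : ℂ) : TensorRel f (FreeAlgebra.ι ℂ (Sum.inl (algebraMap ℂ A c)))
      (algebraMap ℂ _ c)
  | add (a b : A) : TensorRel f (FreeAlgebra.ι ℂ (Sum.inl (a + b)))
      (FreeAlgebra.ι ℂ (Sum.inl a) + FreeAlgebra.ι ℂ (Sum.inl b))
  | mul (a b : A) : TensorRel f (FreeAlgebra.ι ℂ (Sum.inl (a * b)))
      (FreeAlgebra.ι ℂ (Sum.inl a) * FreeAlgebra.ι ℂ (Sum.inl b))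
  | comm (i : I) (a : A) : TensorRel f
      (FreeAlgebra.ι ℂ (Sum.inr i) * FreeAlgebra.ι ℂ (Sum.inl a))
      (∑ j, FreeAlgebra.ι ℂ (Sum.inl (move f i j a)) * FreeAlgebra.ι ℂ (Sum.inr j))

/-- The tensor algebra `A ⊕ Γ ⊕ Γ ⊗_A Γ ⊕ …` of the `A`-bimodule `Γ`, by generators (the elements
of `A` and the left module basis `θ` of `Γ`) and relations. -/
def TensorAlg (f : A →ₐ[ℂ] Matrix I I ℂ) : Type := RingQuot (TensorRel f)

instance (f : A →ₐ[ℂ] Matrix I I ℂ) : Ring (TensorAlg f) :=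
  inferInstanceAs (Ring (RingQuot (TensorRel f)))

instance (f : A →ₐ[ℂ] Matrix I I ℂ) : Algebra ℂ (TensorAlg f) :=
  inferInstanceAs (Algebra ℂ (RingQuot (TensorRel f)))

namespace TensorAlg

variable (f : A →ₐ[ℂ] Matrix I I ℂ)

/-- The embedding of `A` into the tensor algebra. -/
def ofA : A →ₐ[ℂ] TensorAlg f :=
  AlgHom.ofLinearMap
    { toFun := fun a => RingQuot.mkAlgHom ℂ (TensorRel f) (FreeAlgebra.ι ℂ (Sum.inl a))
      map_add' := fun a b =>
        (RingQuot.mkAlgHom_rel ℂ (TensorRel.add (f := f) a b)).trans (map_add _ _ _)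
      map_smul' := fun c a => by
        have h := RingQuot.mkAlgHom_rel ℂ (TensorRel.mul (f := f) (algebraMap ℂ A c) a)
        rw [map_mul, RingQuot.mkAlgHom_rel ℂ (TensorRel.algebraMap (f := f) c),
          ← Algebra.smul_def] at h
        rw [h, AlgHom.commutes, ← Algebra.smul_def]
        rfl }
    (by
      have h := RingQuot.mkAlgHom_rel ℂ (TensorRel.algebraMap (f := f) 1)
      simp only [map_one] at h
      exact h)
    (fun a b => (RingQuot.mkAlgHom_rel ℂ (TensorRel.mul (f := f) a b)).trans (map_mul _ _ _))

/-- The basis one-form `θ i` in the tensor algebra. -/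
def θ (i : I) : TensorAlg f := RingQuot.mkAlgHom ℂ (TensorRel f) (FreeAlgebra.ι ℂ (Sum.inr i))

theorem θ_mul_ofA (i : I) (a : A) : θ f i * ofA f a = ∑ j, ofA f (move f i j a) * θ f j := by
  have h := RingQuot.mkAlgHom_rel ℂ (TensorRel.comm (f := f) i a)
  simp only [map_sum, map_mul] at h
  exact h

/-- The universal property of the tensor algebra. -/
def lift {B : Type*} [Ring B] [Algebra ℂ B] (φ : A →ₐ[ℂ] B) (b : I → B)
    (h : ∀ i a, b i * φ a = ∑ j, φ (move f i j a) * b j) : TensorAlg f →ₐ[ℂ] B :=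
  RingQuot.liftAlgHom ℂ ⟨FreeAlgebra.lift ℂ (Sum.elim φ b), by
    intro x y hxy
    induction hxy with
    | algebraMap c => simp
    | add a b => simp
    | mul a b => simp
    | comm i a => simpa using h i a⟩

@[simp] theorem lift_ofA {B : Type*} [Ring B] [Algebra ℂ B] (φ : A →ₐ[ℂ] B) (b : I → B)
    (h : ∀ i a, b i * φ a = ∑ j, φ (move f i j a) * b j) (a : A) :
    lift f φ b h (ofA f a) = φ a :=
  (RingQuot.liftAlgHom_mkAlgHom_apply ℂ _ _ _).trans (by simp)

@[simp] theorem lift_θ {B : Type*} [Ring B] [Algebra ℂ B] (φ : A →ₐ[ℂ] B) (b : I → B)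
    (h : ∀ i a, b i * φ a = ∑ j, φ (move f i j a) * b j) (i : I) :
    lift f φ b h (θ f i) = b i :=
  (RingQuot.liftAlgHom_mkAlgHom_apply ℂ _ _ _).trans (by simp)

/-- The left coaction on the tensor algebra: `a ↦ Δ(a)`, `θ i ↦ 1 ⊗ θ i`. -/
def coaction : TensorAlg f →ₐ[ℂ] A ⊗[ℂ] TensorAlg f :=
  lift f ((Algebra.TensorProduct.map (AlgHom.id ℂ A) (ofA f)).comp (Bialgebra.comulAlgHom ℂ A))
    (fun i => 1 ⊗ₜ[ℂ] θ f i)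
    (by
      intro i a
      simp only [AlgHom.comp_apply, Bialgebra.comulAlgHom_apply, move, comul_convRight]
      generalize Coalgebra.comul (R := ℂ) a = x
      induction x with
      | zero => simp
      | add x y hx hy => simp only [map_add, mul_add, add_mul, hx, hy, Finset.sum_add_distrib]
      | tmul x y =>
        simp only [LinearMap.lTensor_tmul, Algebra.TensorProduct.map_tmul, AlgHom.id_apply,
          Algebra.TensorProduct.tmul_mul_tmul, one_mul, mul_one, ← TensorProduct.tmul_sum]
        rw [θ_mul_ofA]
        rfl)

@[simp] theorem coaction_ofA (a : A) : coaction f (ofA f a) =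
    (ofA f).toLinearMap.lTensor A (Coalgebra.comul a) := by
  simp only [coaction, lift_ofA]
  rfl

@[simp] theorem coaction_θ (i : I) : coaction f (θ f i) = 1 ⊗ₜ[ℂ] θ f i := by
  simp [coaction]

/-- The canonical map `Γ ⊗_A Γ → T`. -/
def ofSquare : (I × I → A) →ₗ[ℂ] TensorAlg f :=
  ∑ p : I × I, (LinearMap.mulRight ℂ (θ f p.1 * θ f p.2)) ∘ₗ (ofA f).toLinearMap ∘ₗ
    LinearMap.proj p

theorem ofSquare_apply (z : I × I → A) :
    ofSquare f z = ∑ p : I × I, ofA f (z p) * (θ f p.1 * θ f p.2) := by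
  simp [ofSquare, mul_assoc]

theorem coaction_ofSquare (z : I × I → A) :
    coaction f (ofSquare f z) = (ofSquare f).lTensor A (leftCoaction A (I × I) z) := by
  have key : ∀ (p : I × I) (x : A ⊗[ℂ] A),
      (ofA f).toLinearMap.lTensor A x * ((1 : A) ⊗ₜ[ℂ] (θ f p.1 * θ f p.2)) =
        (ofSquare f).lTensor A ((LinearMap.single ℂ (fun _ : I × I => A) p).lTensor A x) := by
    intro p x
    induction x with
    | zero => simp
    | add x y hx hy => simp only [map_add, add_mul, hx, hy]
    | tmul x y =>
      have : ofSquare f (Pi.single p y) = ofA f y * (θ f p.1 * θ f p.2) := by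
        rw [ofSquare_apply, Finset.sum_eq_single p]
        · simp
        · intro q _ hq
          simp [Pi.single_eq_of_ne hq]
        · simp
      simp [this]
  rw [ofSquare_apply]
  simp only [map_sum, map_mul, coaction_ofA, coaction_θ, Algebra.TensorProduct.tmul_mul_tmul,
    one_mul, key, leftCoaction, LinearMap.sum_apply, LinearMap.comp_apply, LinearMap.proj_apply]

end TensorAlg

/-- The relation `ρ₂ ∼ g(ρ₂)` on the tensor algebra, for `ρ₂ ∈ ker(id - σ) ⊆ Γ ⊗_A Γ`. -/
inductive CliffordRel (f : A →ₐ[ℂ] Matrix I I ℂ) (σ : (I × I → A) →ₗ[A] (I × I → A))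
    (g : (I × I → A) →ₗ[A] A) : TensorAlg f → TensorAlg f → Prop
  | rel (z : I × I → A) (hz : z ∈ LinearMap.ker (LinearMap.id - σ)) :
      CliffordRel f σ g (TensorAlg.ofSquare f z) (TensorAlg.ofA f (g z))

/-- The quantum Clifford algebra `Cl(Γ, σ, g)`: the quotient of the tensor algebra by the two-sided
ideal generated by the `ρ₂ - g(ρ₂)`, `ρ₂ ∈ ker(id - σ)`. -/
def Clifford (f : A →ₐ[ℂ] Matrix I I ℂ) (σ : (I × I → A) →ₗ[A] (I × I → A))
    (g : (I × I → A) →ₗ[A] A) : Type := RingQuot (CliffordRel f σ g)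

instance (f : A →ₐ[ℂ] Matrix I I ℂ) (σ : (I × I → A) →ₗ[A] (I × I → A))
    (g : (I × I → A) →ₗ[A] A) : Ring (Clifford f σ g) :=
  inferInstanceAs (Ring (RingQuot (CliffordRel f σ g)))

instance (f : A →ₐ[ℂ] Matrix I I ℂ) (σ : (I × I → A) →ₗ[A] (I × I → A))
    (g : (I × I → A) →ₗ[A] A) : Algebra ℂ (Clifford f σ g) :=
  inferInstanceAs (Algebra ℂ (RingQuot (CliffordRel f σ g)))

/-- Left covariance of a left-linear map between left-covariant modules. -/
def IsLeftCovariant {J K : Type} [Fintype J] [DecidableEq J] [Fintype K] [DecidableEq K]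
    (T : (J → A) →ₗ[A] (K → A)) : Prop :=
  ∀ z, leftCoaction A K (T z) = (T.restrictScalars ℂ).lTensor A (leftCoaction A J z)

theorem leftCoaction_apply (J : Type) [Fintype J] [DecidableEq J] (z : J → A) :
    leftCoaction A J z = ∑ p, (LinearMap.single ℂ (fun _ : J => A) p).lTensor A
      (Coalgebra.comul (R := ℂ) (z p)) := by
  simp [leftCoaction]

theorem braiding_leftCovariant (f : A →ₐ[ℂ] Matrix I I ℂ) (v : I → I → A) :
    IsLeftCovariant (braiding f v) := by
  intro z
  have key : ∀ (q : I × I) (x : A ⊗[ℂ] A),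
      ((braiding f v).restrictScalars ℂ).lTensor A
        ((LinearMap.single ℂ (fun _ : I × I => A) q).lTensor A x) =
      ∑ p : I × I, entry f q.1 p.2 (v p.1 q.2) •
        (LinearMap.single ℂ (fun _ : I × I => A) p).lTensor A x := by
    intro q x
    induction x with
    | zero => simp
    | add x y hx hy => simp only [map_add, hx, hy, smul_add, Finset.sum_add_distrib]
    | tmul x y =>
      have : braiding f v (Pi.single q y) =
          ∑ p : I × I, entry f q.1 p.2 (v p.1 q.2) • Pi.single p y := by
        funext p
        simp [braiding, Finset.sum_apply, Pi.single_apply]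
      simp [this, TensorProduct.tmul_sum]
  simp only [leftCoaction_apply, map_sum, key]
  rw [Finset.sum_comm]
  refine Finset.sum_congr rfl fun p _ => ?_
  simp [braiding]

/-- Left covariance of `g : Γ ⊗_A Γ → A`. -/
def LeftCovariantForm (g : (I × I → A) →ₗ[A] A) : Prop :=
  ∀ z, Coalgebra.comul (R := ℂ) (g z) =
    (g.restrictScalars ℂ).lTensor A (leftCoaction A (I × I) z)

/-! Maps on `Γ ⊗_A Γ ⊗_A Γ`, the free left module `I × I × I → A`, in leg notation. -/

/-- `σ ⊗ id`. -/
def sigma₁₂ (σ : (I × I → A) →ₗ[A] (I × I → A)) (t : I × I × I → A) : I × I × I → A :=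
  fun x => σ (fun p => t (p.1, p.2, x.2.2)) (x.1, x.2.1)

/-- `id ⊗ σ`, for a map `σ` whose matrix with respect to the elements `θ i ⊗ θ j` is complex. -/
def sigma₂₃ (σ : (I × I → A) →ₗ[A] (I × I → A)) (t : I × I × I → A) : I × I × I → A :=
  fun x => σ (fun p => t (x.1, p)) x.2

/-- `g ⊗ id`. -/
def g₁₂ (g : (I × I → A) →ₗ[A] A) (t : I × I × I → A) : I → A :=
  fun k => g (fun p => t (p.1, p.2, k))

/-- `id ⊗ g`: `a θ i ⊗ θ j ⊗ θ k ↦ a θ i · g(θ j ⊗ θ k)`. -/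
def g₂₃ (f : A →ₐ[ℂ] Matrix I I ℂ) (g : (I × I → A) →ₗ[A] A) (t : I × I × I → A) : I → A :=
  fun l => ∑ i, ∑ p : I × I, t (i, p) * move f i l (g (Pi.single p 1))

/-- Bicovariant `σ`-metrics of the bicovariant bimodule given by `f` and `v`, for its canonical
braiding `σ`: non-degenerate homomorphisms `Γ ⊗_A Γ → A` of bicovariant bimodules with
`g σ = g` and `g₁₂ σ₂₃^{±1} σ₁₂^{±1} = g₂₃` (the equation for `-1` is written without inverses).
No compatibility with an involution is required. -/
structure IsBicovariantSigmaMetric (f : A →ₐ[ℂ] Matrix I I ℂ) (v : I → I → A)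
    (g : (I × I → A) →ₗ[A] A) : Prop where
  map_rmul₂ : ∀ z a, g (rmul₂ f z a) = g z * a
  left_covariant : LeftCovariantForm g
  right_covariant : ∀ z, Coalgebra.comul (R := ℂ) (g z) =
    (g.restrictScalars ℂ).rTensor A (rightCoaction₂ v z)
  nondegenerate_left : ∀ x, (∀ y, g (tmul f x y) = 0) → x = 0
  nondegenerate_right : ∀ y, (∀ x, g (tmul f x y) = 0) → y = 0
  comp_braiding : ∀ z, g (braiding f v z) = g z
  braid_pos : ∀ t, g₁₂ g (sigma₂₃ (braiding f v) (sigma₁₂ (braiding f v) t)) = g₂₃ f g t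
  braid_neg : ∀ t, g₁₂ g t = g₂₃ f g (sigma₁₂ (braiding f v) (sigma₂₃ (braiding f v) t))

namespace Clifford

variable (f : A →ₐ[ℂ] Matrix I I ℂ) (σ : (I × I → A) →ₗ[A] (I × I → A))
    (g : (I × I → A) →ₗ[A] A)

/-- The canonical map from the tensor algebra. -/
def mk : TensorAlg f →ₐ[ℂ] Clifford f σ g := RingQuot.mkAlgHom ℂ (CliffordRel f σ g)

theorem mk_ofSquare {z : I × I → A} (hz : z ∈ LinearMap.ker (LinearMap.id - σ)) :
    mk f σ g (TensorAlg.ofSquare f z) = mk f σ g (TensorAlg.ofA f (g z)) :=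
  RingQuot.mkAlgHom_rel ℂ (CliffordRel.rel z hz)

theorem coaction_aux {σ : (I × I → A) →ₗ[A] (I × I → A)} {g : (I × I → A) →ₗ[A] A}
    (hσ : IsLeftCovariant σ) (hg : LeftCovariantForm g) {z : I × I → A}
    (hz : z ∈ LinearMap.ker (LinearMap.id - σ)) :
    (mk f σ g).toLinearMap.lTensor A (TensorAlg.coaction f (TensorAlg.ofSquare f z)) =
      (mk f σ g).toLinearMap.lTensor A (TensorAlg.coaction f (TensorAlg.ofA f (g z))) := by
  let K : (I × I → A) →ₗ[ℂ] (I × I → A) := LinearMap.id - σ.restrictScalars ℂ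
  have hK : K.lTensor A (leftCoaction A (I × I) z) = 0 := by
    have h1 : σ z = z := (sub_eq_zero.mp hz).symm
    have h2 := hσ z
    rw [h1] at h2
    simp only [K, LinearMap.lTensor_sub, LinearMap.lTensor_id, LinearMap.sub_apply,
      LinearMap.id_apply, ← h2, sub_self]
  obtain ⟨w, hw⟩ := (Module.Flat.lTensor_exact A (LinearMap.exact_subtype_ker_map K) _).mp hK
  rw [TensorAlg.coaction_ofSquare, TensorAlg.coaction_ofA, hg z, ← hw]
  clear hw
  induction w with
  | zero => simp
  | add x y hx hy => simp only [map_add, hx, hy]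
  | tmul x y =>
    have hy : (y : I × I → A) ∈ LinearMap.ker (LinearMap.id - σ) := y.2
    simp only [LinearMap.lTensor_tmul, Submodule.subtype_apply, LinearMap.restrictScalars_apply,
      AlgHom.toLinearMap_apply, mk_ofSquare f σ g hy]

/-- The canonical map `A → Cl`. -/
def ofA : A →ₐ[ℂ] Clifford f σ g := (mk f σ g).comp (TensorAlg.ofA f)

/-- The basis one-form `θ i` in `Cl`. -/
def θ (i : I) : Clifford f σ g := mk f σ g (TensorAlg.θ f i)

/-- The left coaction `Cl → A ⊗ Cl`, the algebra map with `a ↦ Δ(a)`, `θ i ↦ 1 ⊗ θ i`. -/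
def coaction {σ : (I × I → A) →ₗ[A] (I × I → A)} {g : (I × I → A) →ₗ[A] A}
    (hσ : IsLeftCovariant σ) (hg : LeftCovariantForm g) :
    Clifford f σ g →ₐ[ℂ] A ⊗[ℂ] Clifford f σ g :=
  RingQuot.liftAlgHom ℂ
    ⟨(Algebra.TensorProduct.map (AlgHom.id ℂ A) (mk f σ g)).comp (TensorAlg.coaction f), by
      intro x y h
      induction h with
        | rel z hz => exact coaction_aux f hσ hg hz⟩

theorem coaction_mk {σ : (I × I → A) →ₗ[A] (I × I → A)} {g : (I × I → A) →ₗ[A] A}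
    (hσ : IsLeftCovariant σ) (hg : LeftCovariantForm g) (x : TensorAlg f) :
    coaction f hσ hg (mk f σ g x) =
      (mk f σ g).toLinearMap.lTensor A (TensorAlg.coaction f x) :=
  RingQuot.liftAlgHom_mkAlgHom_apply ℂ _ _ _

end Clifford

end Bimodule

section Covariant

variable {A : Type} [Ring A] [Bialgebra ℂ A] {C : Type} [Ring C] [Algebra ℂ C]

/-- A left ideal `J` of `C` is left-covariant if `δ(J) ⊆ A ⊗ J`, for a left coaction `δ`. -/
def IsCovariantLeftIdeal (δ : C →ₐ[ℂ] A ⊗[ℂ] C) (J : Ideal C) : Prop :=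
  ∀ x ∈ J, δ x ∈ LinearMap.range ((J.restrictScalars ℂ).subtype.lTensor A)

/-- `C` is a simple left-covariant algebra: it is nonzero and has no left-covariant two-sided ideals
other than `0` and `C`. -/
def IsSimpleCovariant (δ : C →ₐ[ℂ] A ⊗[ℂ] C) : Prop :=
  Nontrivial C ∧ ∀ J : Ideal C, J.IsTwoSided → IsCovariantLeftIdeal δ J → J = ⊥ ∨ J = ⊤

/-- Minimal left-covariant left ideals: minimal among the nonzero left-covariant left ideals. -/
def IsMinimalCovariantLeftIdeal (δ : C →ₐ[ℂ] A ⊗[ℂ] C) (S : Ideal C) : Prop :=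
  Minimal (fun J => IsCovariantLeftIdeal δ J ∧ J ≠ ⊥) S

end Covariant

/-! ## The Hopf algebra `O(SL_q(2))` and the `4D±`-calculi

The parameter is `s = q^{1/2}`, a square root of `q`. The indices `1, 2` are `0, 1 : Fin 2`. -/

section SLq2

/-- `q`. -/
abbrev qParam (s : ℂˣ) : ℂ := (s : ℂ) ^ 2

/-- `q̂ = q - q⁻¹`. -/
abbrev qHat (s : ℂˣ) : ℂ := qParam s - (qParam s)⁻¹

/-- The `R`-matrix, `Rhat s i j k l = R̂^{ij}_{kl}`. -/
def Rhat (s : ℂˣ) (i j k l : Fin 2) : ℂ :=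
  (if i = l ∧ j = k then (if i = j then qParam s else 1) * (s : ℂ)⁻¹ else 0) +
    (if i = 0 ∧ k = 0 ∧ j = 1 ∧ l = 1 then (s : ℂ)⁻¹ * qHat s else 0)

/-- The matrix `Č^{ij}`. -/
def Ccheck (s : ℂˣ) (i j : Fin 2) : ℂ :=
  (if i = 0 ∧ j = 1 then (s : ℂ)⁻¹ else 0) - (if i = 1 ∧ j = 0 then (s : ℂ) else 0)

/-- The matrix `Ĉ_{ij}`. -/
def Chat (s : ℂˣ) (i j : Fin 2) : ℂ := -Ccheck s i j

/-- The inverse of the `R`-matrix, `RhatInv s i j k l = (R̂⁻¹)^{ij}_{kl}`. -/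
def RhatInv (s : ℂˣ) (i j k l : Fin 2) : ℂ :=
  (if i = k ∧ j = l then (s : ℂ)⁻¹ else 0) + (s : ℂ) * (Ccheck s i j * Chat s k l)

theorem sum_Rhat_mul_RhatInv (s : ℂˣ) (i j m n : Fin 2) :
    ∑ k, ∑ l, Rhat s i j k l * RhatInv s k l m n = if i = m ∧ j = n then 1 else 0 := by
  have hs : (s : ℂ) ≠ 0 := s.ne_zero
  fin_cases i <;> fin_cases j <;> fin_cases m <;> fin_cases n <;>
    simp [Rhat, RhatInv, Ccheck, Chat, Fin.sum_univ_two] <;> (field_simp; try ring)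

theorem sum_RhatInv_mul_Rhat (s : ℂˣ) (i j m n : Fin 2) :
    ∑ k, ∑ l, RhatInv s i j k l * Rhat s k l m n = if i = m ∧ j = n then 1 else 0 := by
  have hs : (s : ℂ) ≠ 0 := s.ne_zero
  fin_cases i <;> fin_cases j <;> fin_cases m <;> fin_cases n <;>
    simp [Rhat, RhatInv, Ccheck, Chat, Fin.sum_univ_two] <;> (field_simp; try ring)

/-- The relations `R̂ u u = u u R̂` and `u^1_1 u^2_2 - q u^1_2 u^2_1 = 1`. -/
inductive OSLRel (s : ℂˣ) :
    FreeAlgebra ℂ (Fin 2 × Fin 2) → FreeAlgebra ℂ (Fin 2 × Fin 2) → Prop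
  | rtt (i j m n : Fin 2) : OSLRel s
      (∑ k, ∑ l, Rhat s i j k l • (FreeAlgebra.ι ℂ (k, m) * FreeAlgebra.ι ℂ (l, n)))
      (∑ k, ∑ l, Rhat s k l m n • (FreeAlgebra.ι ℂ (i, k) * FreeAlgebra.ι ℂ (j, l)))
  | det : OSLRel s
      (FreeAlgebra.ι ℂ (0, 0) * FreeAlgebra.ι ℂ (1, 1) -
        qParam s • (FreeAlgebra.ι ℂ (0, 1) * FreeAlgebra.ι ℂ (1, 0))) 1

/-- The algebra `O(SL_q(2))`. -/
def OSL (s : ℂˣ) : Type := RingQuot (OSLRel s)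

instance (s : ℂˣ) : Ring (OSL s) := inferInstanceAs (Ring (RingQuot (OSLRel s)))

instance (s : ℂˣ) : Algebra ℂ (OSL s) := inferInstanceAs (Algebra ℂ (RingQuot (OSLRel s)))

namespace OSL

variable {s : ℂˣ}

/-- The generator `u^i_j`. -/
def u (i j : Fin 2) : OSL s := RingQuot.mkAlgHom ℂ (OSLRel s) (FreeAlgebra.ι ℂ (i, j))

theorem rtt (i j m n : Fin 2) :
    ∑ k, ∑ l, Rhat s i j k l • ((u k m : OSL s) * u l n) =
      ∑ k, ∑ l, Rhat s k l m n • ((u i k : OSL s) * u j l) := by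
  have h := RingQuot.mkAlgHom_rel ℂ (OSLRel.rtt (s := s) i j m n)
  simp only [map_sum, map_smul, map_mul] at h
  exact h

theorem det : (u 0 0 : OSL s) * u 1 1 - qParam s • ((u 0 1 : OSL s) * u 1 0) = 1 := by
  have h := RingQuot.mkAlgHom_rel ℂ (OSLRel.det (s := s))
  simp only [map_sub, map_smul, map_mul, map_one] at h
  exact h

/-- The universal property of `O(SL_q(2))`. -/
def lift {B : Type*} [Ring B] [Algebra ℂ B] (t : Fin 2 → Fin 2 → B)
    (hrtt : ∀ i j m n, ∑ k, ∑ l, Rhat s i j k l • (t k m * t l n) =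
      ∑ k, ∑ l, Rhat s k l m n • (t i k * t j l))
    (hdet : t 0 0 * t 1 1 - qParam s • (t 0 1 * t 1 0) = 1) : OSL s →ₐ[ℂ] B :=
  RingQuot.liftAlgHom ℂ ⟨FreeAlgebra.lift ℂ (fun p : Fin 2 × Fin 2 => t p.1 p.2), by
    intro x y h
    induction h with
    | rtt i j m n =>
      simp only [map_sum, map_smul, map_mul, FreeAlgebra.lift_ι_apply]
      exact hrtt i j m n
    | det =>
      simp only [map_sub, map_smul, map_mul, map_one, FreeAlgebra.lift_ι_apply]
      exact hdet⟩

@[simp] theorem lift_u {B : Type*} [Ring B] [Algebra ℂ B] (t : Fin 2 → Fin 2 → B)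
    (hrtt : ∀ i j m n, ∑ k, ∑ l, Rhat s i j k l • (t k m * t l n) =
      ∑ k, ∑ l, Rhat s k l m n • (t i k * t j l))
    (hdet : t 0 0 * t 1 1 - qParam s • (t 0 1 * t 1 0) = 1) (i j : Fin 2) :
    lift t hrtt hdet (u i j : OSL s) = t i j := by
  simp only [lift, u]
  exact (RingQuot.liftAlgHom_mkAlgHom_apply ℂ _ _ _).trans (by simp)

theorem algHom_ext {B : Type*} [Ring B] [Algebra ℂ B] {φ ψ : OSL s →ₐ[ℂ] B}
    (h : ∀ i j, φ (u i j) = ψ (u i j)) : φ = ψ := by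
  apply RingQuot.ringQuot_ext'
  apply FreeAlgebra.hom_ext
  funext p
  exact h p.1 p.2

theorem u00_u01 : (u 0 0 : OSL s) * u 0 1 = qParam s • ((u 0 1 : OSL s) * u 0 0) := by
  have hs : (s : ℂ) ≠ 0 := s.ne_zero
  have h := rtt (s := s) 0 0 0 1
  simp [Fin.sum_univ_two, Rhat] at h
  linear_combination (norm := skip) ((s : ℂ) ^ 3) • h
  match_scalars <;> field_simp <;> ring

theorem u10_u11 : (u 1 0 : OSL s) * u 1 1 = qParam s • ((u 1 1 : OSL s) * u 1 0) := by
  have hs : (s : ℂ) ≠ 0 := s.ne_zero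
  have h := rtt (s := s) 1 1 0 1
  simp [Fin.sum_univ_two, Rhat] at h
  linear_combination (norm := skip) ((s : ℂ) ^ 3) • h
  match_scalars <;> field_simp <;> ring

theorem u01_u10 : (u 0 1 : OSL s) * u 1 0 = (u 1 0 : OSL s) * u 0 1 := by
  have hs : (s : ℂ) ≠ 0 := s.ne_zero
  have h := rtt (s := s) 1 0 1 0
  simpa [Fin.sum_univ_two, Rhat, hs] using h

theorem u11_u00 : (u 1 1 : OSL s) * u 0 0 = 1 + (qParam s)⁻¹ • ((u 1 0 : OSL s) * u 0 1) := by
  have hs : (s : ℂ) ≠ 0 := s.ne_zero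
  have h2 := rtt (s := s) 1 0 0 1
  simp [Fin.sum_univ_two, Rhat] at h2
  linear_combination (norm := skip) (-(s : ℂ)) • h2 + det (s := s) + qParam s • u01_u10 (s := s)
  match_scalars <;> field_simp <;> ring

/-- The comultiplication `u i j ↦ ∑ k, u i k ⊗ u k j`. -/
def comulHom : OSL s →ₐ[ℂ] OSL s ⊗[ℂ] OSL s :=
  lift (fun i j => ∑ k, u i k ⊗ₜ[ℂ] u k j)
    (by
      intro i j m n
      have e1 : ∀ k l : Fin 2, (∑ a, (u k a : OSL s) ⊗ₜ[ℂ] (u a m : OSL s)) *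
          (∑ b, (u l b : OSL s) ⊗ₜ[ℂ] (u b n : OSL s)) =
          ∑ a, ∑ b, ((u k a : OSL s) * u l b) ⊗ₜ[ℂ] ((u a m : OSL s) * u b n) := by
        intro k l
        simp only [Finset.sum_mul_sum, Algebra.TensorProduct.tmul_mul_tmul]
      have e2 : ∀ k l : Fin 2, (∑ a, (u i a : OSL s) ⊗ₜ[ℂ] (u a k : OSL s)) *
          (∑ b, (u j b : OSL s) ⊗ₜ[ℂ] (u b l : OSL s)) =
          ∑ a, ∑ b, ((u i a : OSL s) * u j b) ⊗ₜ[ℂ] ((u a k : OSL s) * u b l) := by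
        intro k l
        simp only [Finset.sum_mul_sum, Algebra.TensorProduct.tmul_mul_tmul]
      simp only [e1, e2]
      have h1 : ∑ k, ∑ l, Rhat s i j k l • ∑ a, ∑ b,
            ((u k a : OSL s) * u l b) ⊗ₜ[ℂ] ((u a m : OSL s) * u b n) =
          ∑ a, ∑ b, (∑ k, ∑ l, Rhat s i j k l • ((u k a : OSL s) * u l b)) ⊗ₜ[ℂ]
            ((u a m : OSL s) * u b n) := by
        simp only [Fin.sum_univ_two, TensorProduct.add_tmul, ← TensorProduct.smul_tmul', smul_add]
        abel
      have h2 : ∑ k, ∑ l, Rhat s k l m n • ∑ a, ∑ b,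
            ((u i a : OSL s) * u j b) ⊗ₜ[ℂ] ((u a k : OSL s) * u b l) =
          ∑ a, ∑ b, ((u i a : OSL s) * u j b) ⊗ₜ[ℂ]
            (∑ k, ∑ l, Rhat s k l m n • ((u a k : OSL s) * u b l)) := by
        simp only [Fin.sum_univ_two, TensorProduct.tmul_add, TensorProduct.tmul_smul, smul_add]
        abel
      rw [h1, h2]
      simp only [rtt (s := s) i j, ← rtt (s := s) _ _ m n]
      simp only [Fin.sum_univ_two, TensorProduct.add_tmul, TensorProduct.tmul_add,
        TensorProduct.tmul_smul, ← TensorProduct.smul_tmul']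
      abel)
    (by
      have e : ∀ a b : Fin 2, (∑ k, (u 0 k : OSL s) ⊗ₜ[ℂ] (u k a : OSL s)) *
          (∑ k, (u 1 k : OSL s) ⊗ₜ[ℂ] (u k b : OSL s)) =
          ∑ k, ∑ l, ((u 0 k : OSL s) * u 1 l) ⊗ₜ[ℂ] ((u k a : OSL s) * u l b) := by
        intro a b
        simp only [Finset.sum_mul_sum, Algebra.TensorProduct.tmul_mul_tmul]
      rw [e, e]
      have h00 := u00_u01 (s := s)
      have h11 := u10_u11 (s := s)
      have h01 := u01_u10 (s := s)
      have h10 := u11_u00 (s := s)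
      have hd : (u 0 0 : OSL s) * u 1 1 = 1 + qParam s • ((u 0 1 : OSL s) * u 1 0) := by
        rw [← det (s := s)]; abel
      have hs : (s : ℂ) ≠ 0 := s.ne_zero
      simp only [Fin.sum_univ_two, h00, h11, hd, h10, ← h01, TensorProduct.tmul_add,
        TensorProduct.add_tmul, TensorProduct.tmul_smul, ← TensorProduct.smul_tmul',
        Algebra.TensorProduct.one_def]
      match_scalars <;> field_simp <;> ring)

@[simp] theorem comulHom_u (i j : Fin 2) :
    comulHom (u i j : OSL s) = ∑ k, (u i k : OSL s) ⊗ₜ[ℂ] (u k j : OSL s) := by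
  simp [comulHom]

/-- The counit `u i j ↦ δ i j`. -/
def counitHom : OSL s →ₐ[ℂ] ℂ :=
  lift (fun i j => if i = j then 1 else 0)
    (by
      intro i j m n
      fin_cases i <;> fin_cases j <;> fin_cases m <;> fin_cases n <;> simp)
    (by simp)

@[simp] theorem counitHom_u (i j : Fin 2) :
    counitHom (u i j : OSL s) = if i = j then 1 else 0 := by
  simp [counitHom]

instance : Bialgebra ℂ (OSL s) :=
  Bialgebra.ofAlgHom comulHom counitHom
    (algHom_ext fun i j => by
      simp [Fin.sum_univ_two, TensorProduct.add_tmul, TensorProduct.tmul_add]; abel)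
    (algHom_ext fun i j => by
      fin_cases i <;> fin_cases j <;> simp [Fin.sum_univ_two])
    (algHom_ext fun i j => by
      fin_cases i <;> fin_cases j <;> simp [Fin.sum_univ_two])

end OSL


theorem ybP (s : ℂˣ) (i j m n x y : Fin 2) :
    ∑ k, ∑ l, Rhat s i j k l * ∑ z, Rhat s k z x m * Rhat s l y z n =
      ∑ k, ∑ l, Rhat s k l m n * ∑ z, Rhat s i z x k * Rhat s j y z l := by
  have hs : (s : ℂ) ≠ 0 := s.ne_zero
  simp only [Fin.sum_univ_two]
  fin_cases i <;> fin_cases j <;> fin_cases m <;> fin_cases n <;> fin_cases x <;>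
        fin_cases y <;> simp [Rhat] <;> field_simp <;> ring1


theorem ybQ (s : ℂˣ) (i j m n x y : Fin 2) :
    ∑ k, ∑ l, Rhat s i j k l * ∑ z, RhatInv s k z x m * RhatInv s l y z n =
      ∑ k, ∑ l, Rhat s k l m n * ∑ z, RhatInv s i z x k * RhatInv s j y z l := by
  have hs : (s : ℂ) ≠ 0 := s.ne_zero
  simp only [Fin.sum_univ_two]
  fin_cases i <;> fin_cases j <;> fin_cases m <;> fin_cases n <;> fin_cases x <;>
        fin_cases y <;> simp [Rhat, RhatInv, Chat, Ccheck] <;> (try field_simp) <;> ring1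

/-- The first tensor factor of the map `calcHom` below. -/
def auxP (s : ℂˣ) (ν : ℤˣ) : OSL s →ₐ[ℂ] Matrix (Fin 2) (Fin 2) ℂ :=
  OSL.lift (fun m t => ((ν : ℤ) : ℂ) • Matrix.of fun i r => Rhat s m r i t)
    (by
      intro i j m n
      ext x y
      have h := ybP s i j m n x y
      simp only [Matrix.sum_apply, Matrix.smul_apply, Matrix.mul_apply, Matrix.of_apply,
        smul_mul_smul_comm, smul_eq_mul]
      simp only [Finset.mul_sum] at h ⊢
      linear_combination (norm := skip) (((ν : ℤ) : ℂ) * ((ν : ℤ) : ℂ)) * h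
      simp only [Fin.sum_univ_two]
      ring)
    (by
      have hs : (s : ℂ) ≠ 0 := s.ne_zero
      have hν : ((ν : ℤ) : ℂ) * ((ν : ℤ) : ℂ) = 1 := by
        rcases Int.units_eq_one_or ν with h | h <;> simp [h]
      simp only [smul_mul_smul_comm, hν, one_smul]
      ext x y
      fin_cases x <;> fin_cases y <;>
        simp [Matrix.mul_apply, Rhat] <;> field_simp)

/-- The second tensor factor of the map `calcHom` below. -/
def auxQ (s : ℂˣ) : OSL s →ₐ[ℂ] Matrix (Fin 2) (Fin 2) ℂ :=
  OSL.lift (fun t l => Matrix.of fun j x => RhatInv s t x j l)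
    (by
      intro i j m n
      ext x y
      have h := ybQ s i j m n x y
      simp only [Matrix.sum_apply, Matrix.smul_apply, Matrix.mul_apply, Matrix.of_apply,
        smul_eq_mul]
      exact h)
    (by
      have hs : (s : ℂ) ≠ 0 := s.ne_zero
      ext x y
      fin_cases x <;> fin_cases y <;>
        simp [Matrix.mul_apply, RhatInv, Chat, Ccheck])


/-- The matrices `f(u^m_l)` with the entries
`f(u^m_l)_{(i,j),(r,p)} = ν ∑ t, R̂^{mr}_{it} (R̂⁻¹)^{tp}_{jl}`. -/
def fMat (s : ℂˣ) (ν : ℤˣ) (m l : Fin 2) : Matrix (Fin 2 × Fin 2) (Fin 2 × Fin 2) ℂ :=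
  Matrix.of fun x y => ((ν : ℤ) : ℂ) * ∑ t, Rhat s m y.1 x.1 t * RhatInv s t y.2 x.2 l

/-- The map `calcHom` below, as a composition. -/
def auxF (s : ℂˣ) (ν : ℤˣ) : OSL s →ₐ[ℂ] Matrix (Fin 2 × Fin 2) (Fin 2 × Fin 2) ℂ :=
  ((Algebra.TensorProduct.lmul' ℂ (S := ℂ)).mapMatrix.comp
    (Matrix.kroneckerTMulAlgEquiv (Fin 2) (Fin 2) ℂ ℂ ℂ ℂ).toAlgHom).comp
      ((Algebra.TensorProduct.map (auxP s ν) (auxQ s)).comp OSL.comulHom)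

theorem auxF_u (s : ℂˣ) (ν : ℤˣ) (m l : Fin 2) : auxF s ν (OSL.u m l) = fMat s ν m l := by
  ext x y
  simp [auxF, fMat, auxP, auxQ]
  ring

/-- The algebra map `f : O(SL_q(2)) → Mat_4(ℂ)` of the `4D±`-calculus, `ν = ±1`; it encodes the right
multiplication `θ_{ij} u^k_l = ν ∑ R̂^{mr}_{it} (R̂⁻¹)^{tp}_{jl} u^k_m θ_{rp}`. -/
def calcHom (s : ℂˣ) (ν : ℤˣ) : OSL s →ₐ[ℂ] Matrix (Fin 2 × Fin 2) (Fin 2 × Fin 2) ℂ :=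
  OSL.lift (fMat s ν)
    (by
      intro i j m n
      simpa only [map_sum, map_smul, map_mul, auxF_u] using congrArg (auxF s ν) (OSL.rtt i j m n))
    (by
      simpa only [map_sub, map_smul, map_mul, map_one, auxF_u] using congrArg (auxF s ν) OSL.det)

@[simp] theorem calcHom_u (s : ℂˣ) (ν : ℤˣ) (m l : Fin 2) :
    calcHom s ν (OSL.u m l) = fMat s ν m l := by
  simp [calcHom]

/-- The matrix `v` of the right coaction, `Δ_R(θ_{ij}) = ∑ θ_{kl} ⊗ u^k_i u^l_j`. -/
def calcCoaction (s : ℂˣ) (x y : Fin 2 × Fin 2) : OSL s := OSL.u x.1 y.1 * OSL.u x.2 y.2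

/-- The index set of the basis `θ_{ij}` of left-invariant one-forms. -/
abbrev Idx : Type := Fin 2 × Fin 2

/-- The canonical braiding of the `4D±`-calculus. -/
def calcBraiding (s : ℂˣ) (ν : ℤˣ) : (Idx × Idx → OSL s) →ₗ[OSL s] (Idx × Idx → OSL s) :=
  braiding (calcHom s ν) (calcCoaction s)

/-- Bicovariant `σ`-metrics of the `4D±`-calculus. -/
abbrev IsCalcMetric (s : ℂˣ) (ν : ℤˣ) (g : (Idx × Idx → OSL s) →ₗ[OSL s] OSL s) : Prop :=
  IsBicovariantSigmaMetric (calcHom s ν) (calcCoaction s) g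

/-- The quantum Clifford algebra `Cl(Γ, σ, g)` of the `4D±`-calculus. -/
abbrev Cl (s : ℂˣ) (ν : ℤˣ) (g : (Idx × Idx → OSL s) →ₗ[OSL s] OSL s) : Type :=
  Clifford (calcHom s ν) (calcBraiding s ν) g

section

variable {s : ℂˣ} {ν : ℤˣ} (g : (Idx × Idx → OSL s) →ₗ[OSL s] OSL s)

/-- The left coaction of `O(SL_q(2))` on `Cl(Γ, σ, g)`. -/
def clCoaction {g : (Idx × Idx → OSL s) →ₗ[OSL s] OSL s} (hg : IsCalcMetric s ν g) :
    Cl s ν g →ₐ[ℂ] OSL s ⊗[ℂ] Cl s ν g :=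
  Clifford.coaction (calcHom s ν) (braiding_leftCovariant (calcHom s ν) (calcCoaction s))
    hg.left_covariant

/-- The canonical map `O(SL_q(2)) → Cl(Γ, σ, g)`. -/
def clA : OSL s →ₐ[ℂ] Cl s ν g := Clifford.ofA (calcHom s ν) (calcBraiding s ν) g

/-- The one-forms `θ₁₁, θ₁₂, θ₂₁, θ₂₂` in `Cl(Γ, σ, g)`. -/
def θ₁₁ : Cl s ν g := Clifford.θ (calcHom s ν) (calcBraiding s ν) g (0, 0)

def θ₁₂ : Cl s ν g := Clifford.θ (calcHom s ν) (calcBraiding s ν) g (0, 1)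

def θ₂₁ : Cl s ν g := Clifford.θ (calcHom s ν) (calcBraiding s ν) g (1, 0)

def θ₂₂ : Cl s ν g := Clifford.θ (calcHom s ν) (calcBraiding s ν) g (1, 1)

/-- `ψ⁺₁ = q / ([2] c₁) θ₁₁ θ₁₂ θ₂₁ θ₂₂`, where `[2] = q + q⁻¹`. -/
def ψp₁ (c₁ : ℂ) : Cl s ν g :=
  (qParam s / ((qParam s + (qParam s)⁻¹) * c₁)) • (θ₁₁ g * θ₁₂ g * θ₂₁ g * θ₂₂ g)

/-- `ψ⁺₂ = θ₂₁ θ₂₂`. -/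
def ψp₂ : Cl s ν g := θ₂₁ g * θ₂₂ g

/-- `ψ⁻₁ = θ₁₁ θ₂₁ θ₂₂`. -/
def ψm₁ : Cl s ν g := θ₁₁ g * θ₂₁ g * θ₂₂ g

/-- `ψ⁻₂ = q θ₁₂ θ₂₁ θ₂₂`. -/
def ψm₂ : Cl s ν g := qParam s • (θ₁₂ g * θ₂₁ g * θ₂₂ g)

/-- The left ideal `S₀` of `Cl(Γ, σ, g)` generated by the four elements `ψ`. -/
def S₀ (c₁ : ℂ) : Ideal (Cl s ν g) := Ideal.span {ψp₁ g c₁, ψp₂ g, ψm₁ g, ψm₂ g}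

end

end SLq2

end QuantumClifford

end

open QuantumClifford

namespace QuantumClifford

noncomputable section

/-! Over the algebra of left-coinvariants, the Clifford algebra is a full 4 by 4 matrix algebra in
disguise, and left-covariant ideals are governed by their coinvariant elements.

The metric: left covariance makes g(θ_i ⊗ θ_j) a scalar matrix G, and right linearity of g makes G
invariant under the twisted action of each u^m_l. When q ≠ 1 and q² ≠ 1 these linear equations have
a solution space of dimension at most one (`IsCalcMetric.eq_metricEntry`), and g ≠ 0 makes the
constant nonzero.

The algebra: since ν² = 1, the braiding does not depend on ν, and ker(id - σ) is cut out by six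
equations among sixteen coordinates. The ten remaining coordinates give ten rewriting rules that put
products of one-forms in increasing order (`cliffordRelations`). The element θ₂₁θ₂₂ is annihilated
from the left by θ₂₁ and θ₂₂, so it plays the role of a vacuum; applying 1, θ₁₁, θ₁₂, θ₁₁θ₁₂ to it
gives four spinors S_i. There are elements C_j with S_i C_j S_l = δ_{jl} S_i and ∑ S_j C_j = 1,
because 1 + q² ≠ 0 makes the normalising constant invertible. Hence the S_i C_j are coinvariant
matrix units that span Cl over A, and ∑ A S_l is a left ideal. That Cl does not collapse to zero is
seen from its representation on A⁴, with the γ-matrices read off from the action on spinors.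

The ideals: the map P(x) = S(x₍₋₁₎) x₍₀₎, with S the antipode, sends a·w to ε(a) w for coinvariant
w, preserves covariant left ideals, and is inverted by x = x₍₋₁₎ P(x₍₀₎). So a nonzero covariant
left ideal contains a nonzero complex combination of matrix units (or of spinors, inside ∑ A S_l),
and multiplying by matrix units extracts a single coefficient. This yields both simplicity and
minimality. -/

theorem apply_eq_sum_single {A I : Type} [Ring A] [Fintype I] [DecidableEq I]
    (g : (I × I → A) →ₗ[A] A) (z : I × I → A) :
    g z = ∑ p, z p * g (Pi.single p 1) := by
  conv_lhs => rw [pi_eq_sum_univ' z]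
  simp only [map_sum, map_smul, smul_eq_mul]

/-! ### Right multiplication and coinvariants for a general bicovariant bimodule. -/

section Bimodule

variable {A : Type} [Ring A] [Bialgebra ℂ A] {I : Type} [Fintype I] [DecidableEq I]

theorem counit_convRight (φ : A →ₗ[ℂ] ℂ) (a : A) :
    Coalgebra.counit (R := ℂ) (convRight φ a) = φ a := by
  have key : ∀ x : A ⊗[ℂ] A,
      Coalgebra.counit (R := ℂ) ((TensorProduct.rid ℂ A) (φ.lTensor A x)) =
        φ ((TensorProduct.lid ℂ A) ((Coalgebra.counit (R := ℂ)).rTensor A x)) := by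
    intro x
    induction x with
    | zero => simp
    | add x y hx hy => simp only [map_add, hx, hy]
    | tmul x y => simp [mul_comm]
  have h := key (Coalgebra.comul (R := ℂ) a)
  rw [Coalgebra.rTensor_counit_comul, TensorProduct.lid_tmul, one_smul] at h
  exact h

theorem counit_move (f : A →ₐ[ℂ] Matrix I I ℂ) (i j : I) (a : A) :
    Coalgebra.counit (R := ℂ) (move f i j a) = f a i j :=
  counit_convRight _ _

/-- Multiplicativity of Δ and of f combine here; in the bimodule this is associativity, θ_i (a b) =
(θ_i a) b. -/
theorem move_mul (f : A →ₐ[ℂ] Matrix I I ℂ) (i j : I) (a b : A) :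
    move f i j (a * b) = ∑ k, move f i k a * move f k j b := by
  have key : ∀ x y : A ⊗[ℂ] A,
      (TensorProduct.rid ℂ A) ((entry f i j).lTensor A (x * y)) =
        ∑ k, (TensorProduct.rid ℂ A) ((entry f i k).lTensor A x) *
          (TensorProduct.rid ℂ A) ((entry f k j).lTensor A y) := by
    intro x y
    induction x with
    | zero => simp
    | add x x' hx hx' => simp only [add_mul, map_add, hx, hx', Finset.sum_add_distrib]
    | tmul a b =>
      induction y with
      | zero => simp
      | add y y' hy hy' => simp only [mul_add, map_add, hy, hy', Finset.sum_add_distrib]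
      | tmul a' b' =>
        simp [entry, Matrix.mul_apply, Finset.sum_smul, smul_smul, mul_comm]
  have h := key (Coalgebra.comul (R := ℂ) a) (Coalgebra.comul (R := ℂ) b)
  rw [← Bialgebra.comul_mul] at h
  exact h

theorem move_one (f : A →ₐ[ℂ] Matrix I I ℂ) (i j : I) :
    move f i j 1 = if i = j then 1 else 0 := by
  have h : move f i j 1 = (1 : Matrix I I ℂ) i j • (1 : A) := by
    simp [move, convRight, entry, Bialgebra.comul_one, Algebra.TensorProduct.one_def]
  rw [h, Matrix.one_apply]
  split_ifs <;> simp

theorem rmul₂_one (f : A →ₐ[ℂ] Matrix I I ℂ) (z : I × I → A) : rmul₂ f z 1 = z := by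
  funext p
  simp only [rmul₂, move_one]
  rw [Finset.sum_eq_single p]
  · simp [move_one]
  · rintro ⟨q₁, q₂⟩ _ hq
    by_cases h : q₂ = p.2
    · have h' : q₁ ≠ p.1 := fun h' => hq (Prod.ext h' h)
      simp [h, h', move_one]
    · simp [h]
  · simp

theorem rmul₂_mul (f : A →ₐ[ℂ] Matrix I I ℂ) (z : I × I → A) (a b : A) :
    rmul₂ f z (a * b) = rmul₂ f (rmul₂ f z a) b := by
  funext p
  simp only [rmul₂, move_mul, map_sum, Finset.sum_mul, Finset.mul_sum, mul_assoc]
  rw [Finset.sum_comm (s := (Finset.univ : Finset (I × I))) (t := (Finset.univ : Finset (I × I)))]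
  refine Finset.sum_congr rfl fun q _ => ?_
  rw [Fintype.sum_prod_type_right]

theorem rmul₂_add (f : A →ₐ[ℂ] Matrix I I ℂ) (z : I × I → A) (a b : A) :
    rmul₂ f z (a + b) = rmul₂ f z a + rmul₂ f z b := by
  funext p
  simp only [rmul₂, map_add, mul_add, Finset.sum_add_distrib, Pi.add_apply]

theorem rmul₂_smul (f : A →ₐ[ℂ] Matrix I I ℂ) (z : I × I → A) (c : ℂ) (a : A) :
    rmul₂ f z (c • a) = c • rmul₂ f z a := by
  funext p
  simp only [rmul₂, map_smul, mul_smul_comm, Finset.smul_sum, Pi.smul_apply]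

/-- A left-covariant form takes complex values on the left-invariant basis. -/
theorem LeftCovariantForm.apply_single {g : (I × I → A) →ₗ[A] A} (hg : LeftCovariantForm g)
    (p : I × I) :
    g (Pi.single p 1) = algebraMap ℂ A (Coalgebra.counit (R := ℂ) (g (Pi.single p 1))) := by
  have h := hg (Pi.single p 1)
  have h1 : leftCoaction A (I × I) (Pi.single p 1) = 1 ⊗ₜ[ℂ] Pi.single p 1 := by
    rw [leftCoaction_apply, Finset.sum_eq_single p]
    · simp [Bialgebra.comul_one, Algebra.TensorProduct.one_def]
    · intro q _ hq
      simp [Pi.single_eq_of_ne hq]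
    · simp
  rw [h1] at h
  -- A left-coinvariant element of A is a scalar: apply id ⊗ ε to Δ(a) = 1 ⊗ a.
  have h2 := congrArg (fun x => TensorProduct.rid ℂ A
    ((Coalgebra.counit (R := ℂ)).lTensor A x)) h
  simp only [Coalgebra.lTensor_counit_comul] at h2
  simpa [Algebra.algebraMap_eq_smul_one] using h2

/-! ### Clifford algebras: relations, coinvariants and the projection onto them. -/

namespace Clifford

variable {f : A →ₐ[ℂ] Matrix I I ℂ} {σ : (I × I → A) →ₗ[A] (I × I → A)}
    {g : (I × I → A) →ₗ[A] A}

theorem θ_mul_ofA (i : I) (a : A) :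
    θ f σ g i * ofA f σ g a = ∑ j, ofA f σ g (move f i j a) * θ f σ g j := by
  have h := congrArg (mk f σ g) (TensorAlg.θ_mul_ofA f i a)
  simp only [map_mul, map_sum] at h
  exact h

/-- A complex vector in `ker (id - σ)` gives a quadratic relation with complex coefficients. -/
theorem quadratic_relation (w : I × I → ℂ)
    (hw : (fun p => algebraMap ℂ A (w p)) ∈ LinearMap.ker (LinearMap.id - σ)) (G : I × I → ℂ)
    (hG : ∀ p, g (Pi.single p 1) = algebraMap ℂ A (G p)) :
    ∑ p, w p • (θ f σ g p.1 * θ f σ g p.2) = (∑ p, w p * G p) • 1 := by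
  have h := mk_ofSquare f σ g hw
  rw [TensorAlg.ofSquare_apply, apply_eq_sum_single] at h
  simp only [hG, ← map_mul, ← map_sum, AlgHom.commutes] at h
  rw [Algebra.algebraMap_eq_smul_one] at h
  rw [← h]
  simp only [map_sum, ← Algebra.smul_def, map_smul, map_mul]
  rfl

/-- A submodule stable under left multiplication by the generators is a left ideal. -/
theorem mul_mem_of_generators (T : Submodule ℂ (Clifford f σ g))
    (hA : ∀ a, ∀ t ∈ T, ofA f σ g a * t ∈ T) (hθ : ∀ i, ∀ t ∈ T, θ f σ g i * t ∈ T)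
    (x : Clifford f σ g) {t : Clifford f σ g} (ht : t ∈ T) : x * t ∈ T := by
  let π' : FreeAlgebra ℂ (A ⊕ I) →ₐ[ℂ] TensorAlg f := RingQuot.mkAlgHom ℂ (TensorRel f)
  let π : FreeAlgebra ℂ (A ⊕ I) →ₐ[ℂ] Clifford f σ g := (mk f σ g).comp π'
  have hπ : Function.Surjective π :=
    (RingQuot.mkAlgHom_surjective ℂ (CliffordRel f σ g)).comp
      (RingQuot.mkAlgHom_surjective ℂ (TensorRel f))
  obtain ⟨y, rfl⟩ := hπ x
  induction y using FreeAlgebra.induction generalizing t with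
  | grade0 r =>
    rw [AlgHom.commutes, ← Algebra.smul_def]
    exact T.smul_mem r ht
  | grade1 i =>
    cases i with
    | inl a => exact hA a t ht
    | inr i => exact hθ i t ht
  | mul a b ha hb =>
    rw [map_mul, mul_assoc]
    exact ha (hb ht)
  | add a b ha hb =>
    rw [map_add, add_mul]
    exact T.add_mem (ha ht) (hb ht)

variable {hσ : IsLeftCovariant σ} {hg : LeftCovariantForm g}

theorem coaction_ofA (a : A) : coaction f hσ hg (ofA f σ g a) =
    (ofA f σ g).toLinearMap.lTensor A (Coalgebra.comul a) := by
  rw [ofA, AlgHom.comp_apply, coaction_mk, TensorAlg.coaction_ofA, ← LinearMap.lTensor_comp_apply]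
  rfl

theorem coaction_θ (i : I) : coaction f hσ hg (θ f σ g i) = 1 ⊗ₜ[ℂ] θ f σ g i := by
  rw [θ, coaction_mk, TensorAlg.coaction_θ, LinearMap.lTensor_tmul]
  rfl

/-- An algebra map out of the Clifford algebra. -/
def lift {B : Type*} [Ring B] [Algebra ℂ B] (φ : A →ₐ[ℂ] B) (b : I → B)
    (h : ∀ i a, b i * φ a = ∑ j, φ (move f i j a) * b j)
    (hrel : ∀ z ∈ LinearMap.ker (LinearMap.id - σ),
      ∑ p, φ (z p) * (b p.1 * b p.2) = φ (g z)) : Clifford f σ g →ₐ[ℂ] B :=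
  RingQuot.liftAlgHom ℂ ⟨TensorAlg.lift f φ b h, by
    intro x y hxy
    induction hxy with
    | rel z hz => simpa [TensorAlg.ofSquare_apply] using hrel z hz⟩

/-- The coinvariants of the left coaction. -/
def coinvariants (hσ : IsLeftCovariant σ) (hg : LeftCovariantForm g) :
    Subalgebra ℂ (Clifford f σ g) :=
  AlgHom.equalizer (coaction f hσ hg) Algebra.TensorProduct.includeRight

theorem mem_coinvariants {x : Clifford f σ g} :
    x ∈ coinvariants hσ hg ↔ coaction f hσ hg x = 1 ⊗ₜ[ℂ] x := Iff.rfl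

theorem θ_mem_coinvariants (i : I) : θ f σ g i ∈ coinvariants hσ hg := coaction_θ i

theorem coaction_ofA_mul (a : A) {w : Clifford f σ g} (hw : w ∈ coinvariants hσ hg) :
    coaction f hσ hg (ofA f σ g a * w) =
      (LinearMap.mulRight ℂ w ∘ₗ (ofA f σ g).toLinearMap).lTensor A (Coalgebra.comul a) := by
  rw [map_mul, coaction_ofA, mem_coinvariants.1 hw]
  generalize Coalgebra.comul (R := ℂ) a = x
  induction x with
  | zero => simp
  | add x y hx hy => simp only [map_add, add_mul, hx, hy]
  | tmul x y => simp

variable (hσ hg) in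
/-- The map `x ↦ S(x₍₋₁₎) x₍₀₎`. -/
def proj (S : A →ₗ[ℂ] A) : Clifford f σ g →ₗ[ℂ] Clifford f σ g :=
  LinearMap.mul' ℂ _ ∘ₗ TensorProduct.map ((ofA f σ g).toLinearMap ∘ₗ S) LinearMap.id ∘ₗ
    (coaction f hσ hg).toLinearMap

variable {S : A →ₗ[ℂ] A}

/-- Coinvariance of w leaves only the A-factor to coact, so the projection produces S(a₍₁₎) a₍₂₎ w.
-/
theorem proj_ofA_mul (hS : ∀ a, LinearMap.mul' ℂ A (S.rTensor A (Coalgebra.comul a)) =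
      algebraMap ℂ A (Coalgebra.counit a)) (a : A) {w : Clifford f σ g}
    (hw : w ∈ coinvariants hσ hg) :
    proj hσ hg S (ofA f σ g a * w) = Coalgebra.counit (R := ℂ) a • w := by
  have key : ∀ x : A ⊗[ℂ] A, LinearMap.mul' ℂ _
      (TensorProduct.map ((ofA f σ g).toLinearMap ∘ₗ S) LinearMap.id
        ((LinearMap.mulRight ℂ w ∘ₗ (ofA f σ g).toLinearMap).lTensor A x)) =
        ofA f σ g (LinearMap.mul' ℂ A (S.rTensor A x)) * w := by
    intro x
    induction x with
    | zero => simp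
    | add x y hx hy => simp only [map_add, add_mul, hx, hy]
    | tmul x y => simp [mul_assoc]
  have h := key (Coalgebra.comul (R := ℂ) a)
  rw [hS, ← coaction_ofA_mul a hw, AlgHom.commutes, ← Algebra.smul_def] at h
  exact h

/-- If the Clifford algebra is spanned over `A` by coinvariants, then a nonzero covariant left ideal
contains the nonzero projection of one of its elements. -/
theorem exists_proj_ne_zero (hS : ∀ a, LinearMap.mul' ℂ A (S.rTensor A (Coalgebra.comul a)) =
      algebraMap ℂ A (Coalgebra.counit a)) {K : Type*} [Fintype K] {W : K → Clifford f σ g}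
    (hW : ∀ k, W k ∈ coinvariants hσ hg)
    (hspan : ∀ x : Clifford f σ g, ∃ a : K → A, x = ∑ k, ofA f σ g (a k) * W k)
    {J : Ideal (Clifford f σ g)} (hJ : IsCovariantLeftIdeal (coaction f hσ hg) J) (hJ0 : J ≠ ⊥) :
    ∃ y ∈ J, proj hσ hg S y ∈ J ∧ proj hσ hg S y ≠ 0 := by
  -- Covariance puts the coaction of y in A ⊗ J, and J absorbs the left factor S(y₍₋₁₎).
  have hmem : ∀ y ∈ J, proj hσ hg S y ∈ J := by
    intro y hy
    obtain ⟨t, ht⟩ := hJ y hy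
    simp only [proj, LinearMap.comp_apply, AlgHom.toLinearMap_apply, ← ht]
    clear ht
    induction t with
    | zero => simp
    | add x y hx hy => simp only [map_add]; exact J.add_mem hx hy
    | tmul a j =>
      simp only [LinearMap.lTensor_tmul, TensorProduct.map_tmul, LinearMap.mul'_apply]
      exact J.mul_mem_left _ j.2
  -- The reconstruction y = y₍₋₁₎ P(y₍₀₎): on a·w it is the counit identity a₍₁₎ ε(a₍₂₎) = a. Hence
  -- P cannot vanish on all of a nonzero covariant J.
  have hrec : ∀ y : Clifford f σ g, LinearMap.mul' ℂ _
      (TensorProduct.map (ofA f σ g).toLinearMap (proj hσ hg S) (coaction f hσ hg y)) = y := by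
    intro y
    obtain ⟨a, rfl⟩ := hspan y
    simp only [map_sum]
    refine Finset.sum_congr rfl fun k _ => ?_
    rw [coaction_ofA_mul _ (hW k)]
    have key : ∀ x : A ⊗[ℂ] A, LinearMap.mul' ℂ _
        (TensorProduct.map (ofA f σ g).toLinearMap (proj hσ hg S)
          ((LinearMap.mulRight ℂ (W k) ∘ₗ (ofA f σ g).toLinearMap).lTensor A x)) =
          ofA f σ g (TensorProduct.rid ℂ A ((Coalgebra.counit (R := ℂ)).lTensor A x)) * W k := by
      intro x
      induction x with
      | zero => simp
      | add x y hx hy => simp only [map_add, add_mul, hx, hy]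
      | tmul x y => simp [proj_ofA_mul hS y (hW k)]
    rw [key, Coalgebra.lTensor_counit_comul]
    simp
  by_contra! hcon
  have hzero : ∀ y ∈ J, proj hσ hg S y = 0 := fun y hy => hcon y hy (hmem y hy)
  refine hJ0 (J.eq_bot_iff.2 fun y hy => ?_)
  obtain ⟨t, ht⟩ := hJ y hy
  rw [← hrec y, ← ht]
  clear ht
  induction t with
  | zero => simp
  | add x y hx hy => simp only [map_add, hx, hy, add_zero]
  | tmul a j => simp [hzero j j.2]

end Clifford

end Bimodule

/-! ### The antipode of O(SL_q(2)). -/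

namespace OSL

variable {s : ℂˣ}

theorem u00_u10 : (u 0 0 : OSL s) * u 1 0 = qParam s • ((u 1 0 : OSL s) * u 0 0) := by
  have hs : (s : ℂ) ≠ 0 := s.ne_zero
  have h := rtt (s := s) 0 1 0 0
  simp [Fin.sum_univ_two, Rhat] at h
  linear_combination (norm := skip) (-(s : ℂ) ^ 3) • h
  match_scalars <;> field_simp <;> ring

theorem u01_u11 : (u 0 1 : OSL s) * u 1 1 = qParam s • ((u 1 1 : OSL s) * u 0 1) := by
  have hs : (s : ℂ) ≠ 0 := s.ne_zero
  have h := rtt (s := s) 0 1 1 1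
  simp [Fin.sum_univ_two, Rhat] at h
  linear_combination (norm := skip) (-(s : ℂ) ^ 3) • h
  match_scalars <;> field_simp <;> ring

theorem u00_u11 : (u 0 0 : OSL s) * u 1 1 = 1 + qParam s • ((u 1 0 : OSL s) * u 0 1) := by
  rw [← det (s := s), u01_u10]
  abel

/-- The antipode, as an algebra map to the opposite algebra. -/
def antipodeHom : OSL s →ₐ[ℂ] (OSL s)ᵐᵒᵖ :=
  lift (fun i j => MulOpposite.op (if i = 0 then (if j = 0 then u 1 1 else -(qParam s)⁻¹ • u 0 1)
      else (if j = 0 then -qParam s • u 1 0 else u 0 0)))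
    (by
      have hs : (s : ℂ) ≠ 0 := s.ne_zero
      intro i j m n
      apply MulOpposite.unop_injective
      fin_cases i <;> fin_cases j <;> fin_cases m <;> fin_cases n <;>
        simp [Fin.sum_univ_two, Rhat, u00_u01, u10_u11, u00_u10, u01_u11, u01_u10, u00_u11,
          u11_u00] <;> try (match_scalars <;> field_simp <;> ring))
    (by
      have hs : (s : ℂ) ≠ 0 := s.ne_zero
      apply MulOpposite.unop_injective
      simp [u00_u11])

/-- The antipode. -/
def antipode : OSL s →ₗ[ℂ] OSL s :=
  (MulOpposite.opLinearEquiv ℂ).symm.toLinearMap ∘ₗ antipodeHom.toLinearMap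

theorem antipode_mul (a b : OSL s) : antipode (a * b) = antipode b * antipode a := by
  simp [antipode]

theorem antipode_one : antipode (1 : OSL s) = 1 := by
  simp [antipode]

theorem antipode_u (i j : Fin 2) : antipode (u i j : OSL s) =
    if i = 0 then (if j = 0 then u 1 1 else -(qParam s)⁻¹ • u 0 1)
      else (if j = 0 then -qParam s • u 1 0 else u 0 0) := by
  simp [antipode, antipodeHom]

@[elab_as_elim]
theorem induction {P : OSL s → Prop} (algebraMap : ∀ c : ℂ, P (algebraMap ℂ _ c))
    (u : ∀ i j, P (u i j)) (mul : ∀ a b, P a → P b → P (a * b))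
    (add : ∀ a b, P a → P b → P (a + b)) (a : OSL s) : P a := by
  let π : FreeAlgebra ℂ (Fin 2 × Fin 2) →ₐ[ℂ] OSL s := RingQuot.mkAlgHom ℂ (OSLRel s)
  have hπ : Function.Surjective π := RingQuot.mkAlgHom_surjective ℂ (OSLRel s)
  obtain ⟨y, rfl⟩ := hπ a
  induction y using FreeAlgebra.induction with
  | grade0 r => rw [AlgHom.commutes]; exact algebraMap r
  | grade1 i => exact u i.1 i.2
  | mul a b ha hb => rw [map_mul]; exact mul _ _ ha hb
  | add a b ha hb => rw [map_add]; exact add _ _ ha hb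

theorem comul_u (i j : Fin 2) : Coalgebra.comul (R := ℂ) (u i j : OSL s) =
    ∑ k, (u i k : OSL s) ⊗ₜ[ℂ] (u k j : OSL s) := comulHom_u i j

theorem counit_u (i j : Fin 2) :
    Coalgebra.counit (R := ℂ) (u i j : OSL s) = if i = j then 1 else 0 := counitHom_u i j

/-- Checked on generators and propagated to products: in S(b₍₁₎) S(a₍₁₎) a₍₂₎ b₍₂₎ the inner pair
collapses to the scalar ε(a). -/
theorem mul_antipode_rTensor_comul (a : OSL s) :
    LinearMap.mul' ℂ (OSL s) (antipode.rTensor (OSL s) (Coalgebra.comul a)) =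
      algebraMap ℂ (OSL s) (Coalgebra.counit a) := by
  induction a using OSL.induction with
  | algebraMap c =>
    simp [Algebra.algebraMap_eq_smul_one, Bialgebra.comul_one, Algebra.TensorProduct.one_def,
      antipode_one]
  | u i j =>
    have hs : (s : ℂ) ≠ 0 := s.ne_zero
    rw [comul_u, counit_u]
    fin_cases i <;> fin_cases j <;>
      simp [Fin.sum_univ_two, antipode_u, u00_u10, u00_u11, u01_u10, u01_u11, u11_u00, hs]
  | mul a b ha hb =>
    have key : ∀ y : OSL s ⊗[ℂ] OSL s,
        LinearMap.mul' ℂ (OSL s) (antipode.rTensor (OSL s) (Coalgebra.comul a * y)) =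
          (Coalgebra.counit (R := ℂ) a) •
            LinearMap.mul' ℂ (OSL s) (antipode.rTensor (OSL s) y) := by
      intro y
      induction y with
      | zero => simp
      | add y z hy hz => simp only [mul_add, map_add, hy, hz, smul_add]
      | tmul c d =>
        have h : ∀ x : OSL s ⊗[ℂ] OSL s,
            LinearMap.mul' ℂ (OSL s) (antipode.rTensor (OSL s) (x * (c ⊗ₜ[ℂ] d))) =
              antipode c * LinearMap.mul' ℂ (OSL s) (antipode.rTensor (OSL s) x) * d := by
          intro x
          induction x with
          | zero => simp
          | add y z hy hz => simp only [add_mul, mul_add, map_add, hy, hz]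
          | tmul x y => simp [antipode_mul, mul_assoc]
        rw [h, ha]
        simp [Algebra.algebraMap_eq_smul_one]
    rw [Bialgebra.comul_mul, key, hb, Bialgebra.counit_mul, map_mul, Algebra.smul_def]
  | add a b ha hb => simp only [map_add, ha, hb]

instance : Nontrivial (OSL s) :=
  (Bialgebra.counitAlgHom ℂ (OSL s)).toRingHom.domain_nontrivial

end OSL

/-! ### The braiding of the 4D± calculus and the uniqueness of its metric. -/

section Calculus

variable {s : ℂˣ} {ν : ℤˣ}

/-- The entries of `f(u^m_l)` for `ν = 1`. -/
def fEntry (s : ℂˣ) (m l : Fin 2) (x y : Idx) : ℂ :=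
  if m = 0 then
    if l = 0 then
      if x = y then (if x = (0, 1) then qParam s else if x = (1, 0) then (qParam s)⁻¹ else 1)
      else if x = (0, 1) ∧ y = (1, 0) then -qHat s ^ 2 else 0
    else if x = (0, 0) ∧ y = (1, 0) then qHat s
    else if x = (0, 1) ∧ y = (1, 1) then 1 - (qParam s)⁻¹ ^ 2 else 0
  else
    if l = 0 then
      if x = (0, 1) ∧ y = (0, 0) then -qHat s
      else if x = (1, 1) ∧ y = (1, 0) then 1 - qParam s ^ 2 else 0
    else if x = y then (if x = (0, 1) then (qParam s)⁻¹ else if x = (1, 0) then qParam s else 1)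
    else 0

theorem fMat_apply (m l : Fin 2) (x y : Idx) :
    fMat s ν m l x y = ((ν : ℤ) : ℂ) * fEntry s m l x y := by
  have hs : (s : ℂ) ≠ 0 := s.ne_zero
  obtain ⟨x₁, x₂⟩ := x
  obtain ⟨y₁, y₂⟩ := y
  simp only [fMat, Matrix.of_apply]
  congr 1
  fin_cases m <;> fin_cases l <;> fin_cases x₁ <;> fin_cases x₂ <;> fin_cases y₁ <;>
    fin_cases y₂ <;> simp [fEntry, Rhat, RhatInv, Chat, Ccheck] <;>
    try (field_simp <;> try ring)

theorem units_mul_self (ν : ℤˣ) : ((ν : ℤ) : ℂ) * ((ν : ℤ) : ℂ) = 1 := by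
  rcases Int.units_eq_one_or ν with h | h <;> simp [h]

theorem calcBraiding_apply (z : Idx × Idx → OSL s) (p : Idx × Idx) :
    calcBraiding s ν z p = ∑ q : Idx × Idx,
      (∑ k, fEntry s p.1.1 q.2.1 q.1 k * fEntry s p.1.2 q.2.2 k p.2) • z q := by
  simp only [calcBraiding, braiding, LinearMap.coe_mk, AddHom.coe_mk, entry,
    LinearMap.comp_apply, AlgHom.toLinearMap_apply, calcCoaction, map_mul, calcHom_u,
    Matrix.entryLinearMap_apply, Matrix.mul_apply, fMat_apply]
  refine Finset.sum_congr rfl fun q _ => ?_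
  congr 1
  refine Finset.sum_congr rfl fun k _ => ?_
  -- The entries of v are quadratic in u, so ν enters squared and drops out.
  linear_combination (fEntry s p.1.1 q.2.1 q.1 k * fEntry s p.1.2 q.2.2 k p.2) * units_mul_self ν

/-- The six equations that cut out `ker (id - σ)`. -/
def IsSymmetric (z : Idx × Idx → OSL s) : Prop :=
  z ((0, 0), (0, 1)) = qParam s ^ 2 • z ((0, 1), (0, 0)) ∧
  z ((0, 0), (1, 0)) = qHat s • z ((0, 1), (0, 0)) + z ((1, 0), (0, 0)) ∧
  z ((0, 0), (1, 1)) = qHat s • z ((0, 1), (0, 1)) +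
    (1 - (qParam s)⁻¹ ^ 2) • z ((1, 0), (0, 1)) + z ((1, 1), (0, 0)) ∧
  z ((0, 1), (1, 0)) = z ((1, 0), (0, 1)) ∧
  z ((0, 1), (1, 1)) = qParam s ^ 2 • z ((1, 1), (0, 1)) ∧
  z ((1, 0), (1, 1)) = qHat s • z ((1, 1), (0, 1)) + z ((1, 1), (1, 0))

theorem IsSymmetric.calcBraiding_eq {z : Idx × Idx → OSL s} (hz : IsSymmetric z) :
    calcBraiding s ν z = z := by
  have hs : (s : ℂ) ≠ 0 := s.ne_zero
  obtain ⟨h1, h2, h3, h4, h5, h6⟩ := hz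
  funext p
  rw [calcBraiding_apply]
  obtain ⟨⟨p₁, p₂⟩, ⟨p₃, p₄⟩⟩ := p
  fin_cases p₁ <;> fin_cases p₂ <;> fin_cases p₃ <;> fin_cases p₄ <;>
    simp [Fintype.sum_prod_type, Fin.sum_univ_two, fEntry, h1, h2, h3, h4, h5, h6] <;>
    try (match_scalars <;> field_simp <;> ring)

/-- Six of the sixteen components of σ z = z already imply the equations. -/
theorem isSymmetric_of_calcBraiding_eq {z : Idx × Idx → OSL s} (hz : calcBraiding s ν z = z) :
    IsSymmetric z := by
  have hs : (s : ℂ) ≠ 0 := s.ne_zero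
  have h := fun p => (calcBraiding_apply (ν := ν) z p).symm.trans (congrFun hz p)
  have h1 := h ((0, 0), (0, 1))
  have h2 := h ((0, 0), (1, 0))
  have h3 := h ((1, 1), (0, 0))
  have h4 := h ((1, 0), (0, 1))
  have h5 := h ((1, 1), (0, 1))
  have h6 := h ((1, 1), (1, 0))
  simp [Fintype.sum_prod_type, Fin.sum_univ_two, fEntry] at h1 h2 h3 h4 h5 h6
  refine ⟨?_, ?_, ?_, h4, ?_, ?_⟩
  · linear_combination (norm := module) (-1 : ℂ) • h1
  · linear_combination (norm := skip) (-qParam s ^ 2) • h2 - (qParam s ^ 2 * qHat s) • h1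
    match_scalars <;> field_simp <;> ring
  · linear_combination (norm := skip) h3 + (1 - (qParam s)⁻¹ ^ 2) • h4
    match_scalars <;> field_simp <;> ring
  · linear_combination (norm := skip) (qParam s ^ 2) • h5
    match_scalars <;> field_simp <;> ring
  · linear_combination (norm := skip) ((qParam s)⁻¹ ^ 2) • h6
    match_scalars <;> field_simp <;> ring

theorem mem_ker_calcBraiding {z : Idx × Idx → OSL s} :
    z ∈ LinearMap.ker (LinearMap.id - calcBraiding s ν) ↔ IsSymmetric z := by
  rw [LinearMap.mem_ker, LinearMap.sub_apply, LinearMap.id_apply, sub_eq_zero]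
  exact ⟨fun h => isSymmetric_of_calcBraiding_eq h.symm, fun h => h.calcBraiding_eq.symm⟩

theorem move_calcHom_u (m l : Fin 2) (x y : Idx) :
    move (calcHom s ν) x y (OSL.u m l) = ∑ t, fMat s ν t l x y • (OSL.u m t : OSL s) := by
  simp [move, convRight, OSL.comul_u, entry]

theorem rmul₂_u (z : Idx × Idx → OSL s) (m l : Fin 2) (p : Idx × Idx) :
    rmul₂ (calcHom s ν) z (OSL.u m l) p = ∑ r, ∑ q : Idx × Idx,
      (∑ t, fEntry s r t q.1 p.1 * fEntry s t l q.2 p.2) • (z q * OSL.u m r) := by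
  rw [Finset.sum_comm]
  refine Finset.sum_congr rfl fun q _ => ?_
  simp only [move_calcHom_u, map_sum, map_smul, fMat_apply, Finset.mul_sum,
    Finset.smul_sum, Finset.sum_smul, mul_smul_comm, smul_smul]
  rw [Finset.sum_comm]
  refine Finset.sum_congr rfl fun r _ => Finset.sum_congr rfl fun t _ => ?_
  congr 1
  linear_combination (fEntry s r t q.1 p.1 * fEntry s t l q.2 p.2) * units_mul_self ν

theorem IsSymmetric.rmul₂_u {z : Idx × Idx → OSL s} (hz : IsSymmetric z) (m l : Fin 2) :
    IsSymmetric (rmul₂ (calcHom s ν) z (OSL.u m l)) := by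
  have hs : (s : ℂ) ≠ 0 := s.ne_zero
  obtain ⟨h1, h2, h3, h4, h5, h6⟩ := hz
  simp only [IsSymmetric, QuantumClifford.rmul₂_u]
  fin_cases l <;> refine ⟨?_, ?_, ?_, ?_, ?_, ?_⟩ <;>
    simp [Fintype.sum_prod_type, Fin.sum_univ_two, fEntry, h1, h2, h3, h4, h5, h6, add_mul] <;>
    try (match_scalars <;> field_simp <;> ring)

/-- This is right linearity of σ seen on its fixed space: stability under the generators u^m_l,
computed by hand, passes to products and sums. It makes the spinor representation well defined. -/
theorem IsSymmetric.rmul₂ {z : Idx × Idx → OSL s} (hz : IsSymmetric z) (a : OSL s) :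
    IsSymmetric (rmul₂ (calcHom s ν) z a) := by
  induction a using OSL.induction generalizing z with
  | algebraMap c =>
    rw [Algebra.algebraMap_eq_smul_one, rmul₂_smul, rmul₂_one, ← mem_ker_calcBraiding (ν := ν)]
    rw [← mem_ker_calcBraiding (ν := ν)] at hz
    have := Submodule.smul_mem _ (algebraMap ℂ (OSL s) c) hz
    rwa [algebraMap_smul] at this
  | u i j => exact hz.rmul₂_u i j
  | mul a b ha hb =>
    rw [rmul₂_mul]
    exact hb (ha hz)
  | add a b ha hb =>
    rw [rmul₂_add, ← mem_ker_calcBraiding (ν := ν)]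
    exact Submodule.add_mem _ (mem_ker_calcBraiding.2 (ha hz)) (mem_ker_calcBraiding.2 (hb hz))

/-- Invariance of the complex matrix of a `σ`-metric under `f ⊗ f`. -/
theorem IsCalcMetric.invariant {g : (Idx × Idx → OSL s) →ₗ[OSL s] OSL s}
    (hg : IsCalcMetric s ν g) {G : Idx × Idx → ℂ}
    (hG : ∀ p, g (Pi.single p 1) = algebraMap ℂ (OSL s) (G p)) (m l : Fin 2) (p : Idx × Idx) :
    ∑ q : Idx × Idx, (∑ t, fEntry s m t p.1 q.1 * fEntry s t l p.2 q.2) * G q =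
      (if m = l then 1 else 0) * G p := by
  -- The counit of g(θ_p · u) = g(θ_p) u is a scalar equation, since ε turns a₍₁₎ f(a₍₂₎) into f(a).
  have h := congrArg (Coalgebra.counit (R := ℂ)) (hg.map_rmul₂ (Pi.single p 1) (OSL.u m l))
  rw [apply_eq_sum_single] at h
  simp only [hG, map_sum, Bialgebra.counit_mul, Bialgebra.counit_algebraMap, OSL.counit_u] at h
  rw [mul_comm (G p)] at h
  rw [← h]
  refine Finset.sum_congr rfl fun q _ => ?_
  congr 1
  rw [QuantumClifford.rmul₂, map_sum, Finset.sum_eq_single p]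
  · rw [Pi.single_eq_same, one_mul, counit_move]
    simp only [move_calcHom_u, map_sum, map_smul, Matrix.sum_apply, Matrix.smul_apply, calcHom_u,
      fMat_apply, smul_eq_mul]
    refine Finset.sum_congr rfl fun t _ => ?_
    linear_combination (-fEntry s m t p.1 q.1 * fEntry s t l p.2 q.2) * units_mul_self ν
  · intro r _ hr
    simp [Pi.single_eq_of_ne hr]
  · simp

/-- The matrix of the `σ`-metric with parameter `c`. -/
def metricEntry (s : ℂˣ) (c : ℂ) (p : Idx × Idx) : ℂ :=
  -(s : ℂ) * c * ∑ m, ∑ n, Chat s p.1.1 m * Chat s n p.2.2 * RhatInv s m n p.1.2 p.2.1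

/-- The diagonal parts of f(u^1_1) and f(u^2_2) are powers of q, so invariance kills every entry of
G of nontrivial weight; the off-diagonal parts kill two further entries and tie the surviving ones
to a single free value. -/
theorem IsCalcMetric.eq_metricEntry {g : (Idx × Idx → OSL s) →ₗ[OSL s] OSL s}
    (hg : IsCalcMetric s ν g) (hq1 : qParam s ≠ 1) (hq2 : qParam s ^ 2 ≠ 1) :
    ∃ c : ℂ, ∀ p, g (Pi.single p 1) = algebraMap ℂ (OSL s) (metricEntry s c p) := by
  have hs : (s : ℂ) ≠ 0 := s.ne_zero
  set G : Idx × Idx → ℂ := fun p => Coalgebra.counit (R := ℂ) (g (Pi.single p 1)) with hGdef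
  have hG : ∀ p, g (Pi.single p 1) = algebraMap ℂ (OSL s) (G p) :=
    fun p => hg.left_covariant.apply_single p
  clear_value G
  -- The entry of `metricEntry` at θ₁₁ ⊗ θ₂₂ is -c, which fixes the constant.
  refine ⟨-G ((0, 0), (1, 1)), fun p => ?_⟩
  rw [hG]
  congr 1
  have e := hg.invariant hG
  -- With θ₁₁, θ₁₂, θ₂₁, θ₂₂ numbered 0 to 3, the equation `eij` is the one solved for the entry of
  -- G at (i, j).
  have e00 := e 1 0 ((0, 0), (0, 1))
  have e02 := e 0 0 ((0, 0), (1, 0))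
  have e20 := e 0 0 ((1, 0), (0, 0))
  have e22 := e 0 0 ((1, 0), (1, 0))
  have e23 := e 0 0 ((1, 0), (1, 1))
  have e32 := e 0 0 ((1, 1), (1, 0))
  have e01 := e 1 1 ((0, 0), (0, 1))
  have e10 := e 1 1 ((0, 1), (0, 0))
  have e13 := e 1 1 ((0, 1), (1, 1))
  have e31 := e 1 1 ((1, 1), (0, 1))
  have e33 := e 0 1 ((0, 1), (1, 1))
  have e12 := e 1 0 ((0, 1), (1, 1))
  have e21 := e 0 1 ((0, 0), (0, 1))
  have e30 := e 1 0 ((1, 1), (0, 1))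
  have e11 := e 1 1 ((0, 1), (0, 1))
  clear e
  simp [Fintype.sum_prod_type, Fin.sum_univ_two, fEntry]
    at e00 e02 e20 e22 e23 e32 e01 e10 e13 e31 e33 e12 e21 e30 e11
  have hi : (qParam s)⁻¹ ^ 2 - 1 ≠ 0 := by
    rw [inv_pow, sub_ne_zero]
    simpa using hq2
  have z : ∀ x, (qParam s)⁻¹ * x = x → x = 0 := fun x hx => by
    have h1 : ((qParam s)⁻¹ - 1) * x = 0 := by linear_combination hx
    exact (mul_eq_zero.1 h1).resolve_left (sub_ne_zero.2 (by simpa using hq1))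
  have hq0 : qParam s ≠ 0 := pow_ne_zero 2 hs
  replace e00 := e00.resolve_left fun h => hi (by
    linear_combination (norm := skip) (qParam s)⁻¹ * h
    field_simp; ring)
  replace e33 := e33.resolve_left fun h => hi (by
    linear_combination (norm := skip) -h
    field_simp; ring)
  replace e02 := z _ e02
  replace e20 := z _ e20
  replace e23 := z _ e23
  replace e32 := z _ e32
  replace e01 := z _ e01
  replace e13 := z _ e13
  -- These two weight equations carry an off-diagonal term, which vanishes by the entries already
  -- found.
  rw [e02, mul_zero, zero_add] at e10
  rw [e23, mul_zero, zero_add] at e31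
  replace e10 := z _ e10
  replace e31 := z _ e31
  replace e22 : G ((1, 0), (1, 0)) = 0 := (mul_eq_zero.1
    (show ((qParam s)⁻¹ ^ 2 - 1) * G ((1, 0), (1, 0)) = 0 by linear_combination e22)).resolve_left hi
  -- The surviving entries are now expressed through G at θ₁₁ ⊗ θ₂₂.
  replace e12 : G ((0, 1), (1, 0)) = -G ((0, 0), (1, 1)) := mul_left_cancel₀ hi (by
    linear_combination (norm := skip) (qParam s)⁻¹ * e12
    field_simp; ring)
  replace e21 : G ((1, 0), (0, 1)) = -G ((0, 0), (1, 1)) := mul_left_cancel₀ hi (by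
    linear_combination (norm := skip) -e21
    field_simp; ring)
  replace e30 : G ((1, 1), (0, 0)) = qParam s ^ 2 * G ((0, 0), (1, 1)) := mul_left_cancel₀ hi (by
    rw [e21, e22] at e30
    linear_combination (norm := skip) (qParam s)⁻¹ * e30
    field_simp; ring)
  replace e11 : G ((0, 1), (0, 1)) = ((qParam s)⁻¹ - qParam s) * G ((0, 0), (1, 1)) :=
    mul_left_cancel₀ hi (by
      linear_combination (norm := skip) e11
      field_simp; ring)
  obtain ⟨⟨p₁, p₂⟩, ⟨p₃, p₄⟩⟩ := p
  fin_cases p₁ <;> fin_cases p₂ <;> fin_cases p₃ <;> fin_cases p₄ <;>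
    simp [metricEntry, Fin.sum_univ_two, Chat, Ccheck, RhatInv, e00, e01, e02, e10, e11, e12, e13,
      e20, e21, e22, e23, e30, e31, e32, e33] <;>
    try (field_simp <;> try ring)

theorem IsCalcMetric.ne_zero {g : (Idx × Idx → OSL s) →ₗ[OSL s] OSL s}
    (hg : IsCalcMetric s ν g) : g ≠ 0 := by
  rintro rfl
  have h := congrFun (hg.nondegenerate_left (Pi.single (0, 0) 1) (by simp)) (0, 0)
  simp at h

end Calculus

/-! ### Spinors and matrix units from the quadratic relations alone. -/

section Relations

variable {C : Type*} [Ring C] [Algebra ℂ C]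

/-- The relations of the one-forms `θ₁₁, θ₁₂, θ₂₁, θ₂₂` in the Clifford algebra with parameter `k`. -/
structure CliffordRelations (s : ℂˣ) (k : ℂ) (a b c d : C) : Prop where
  aa : a * a = 0
  ba : b * a = -qParam s ^ 2 • (a * b) - qHat s • (a * c)
  bb : b * b = -qHat s • (a * d)
  ca : c * a = -(a * c)
  cb : c * b = -(b * c) - (1 - (qParam s)⁻¹ ^ 2) • (a * d) + ((1 + (qParam s)⁻¹ ^ 2) * k) • 1
  cc : c * c = 0
  da : d * a = -(a * d) - ((1 + qParam s ^ 2) * k) • 1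
  db : d * b = -qParam s ^ 2 • (b * d) - qHat s • (c * d)
  dc : d * c = -(c * d)
  dd : d * d = 0

/-- The basis of the spinor module. -/
def spinor (a b c d : C) : Fin 4 → C :=
  ![a * (b * (c * d)), c * d, a * (c * d), b * (c * d)]

/-- The action of the one-forms on the basis of the spinor module:
`θ i * spinor k = ∑ l, gamma i l k • spinor l`. -/
def gamma (s : ℂˣ) (k : ℂ) (i : Idx) : Matrix (Fin 4) (Fin 4) ℂ :=
  if i = (0, 0) then !![0, 0, 0, 1; 0, 0, 0, 0; 0, 1, 0, 0; 0, 0, 0, 0]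
  else if i = (0, 1) then !![0, 0, -qParam s ^ 2, 0; 0, 0, 0, 0;
    -qHat s * ((1 + (qParam s)⁻¹ ^ 2) * k), 0, 0, 0; 0, 1, 0, 0]
  else if i = (1, 0) then !![0, 0, 0, 0; 0, 0, 0, (1 + (qParam s)⁻¹ ^ 2) * k;
    -((1 + (qParam s)⁻¹ ^ 2) * k), 0, 0, 0; 0, 0, 0, 0]
  else !![0, 0, 0, 0; 0, 0, -((1 + qParam s ^ 2) * k), 0; 0, 0, 0, 0;
    -((1 + qParam s ^ 2) * k), 0, 0, 0]

/-- The basis dual to the spinors, up to the factor `spinorNorm`. -/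
def cospinor (s : ℂˣ) (a b : C) : Fin 4 → C :=
  ![1, a * b, -(qParam s)⁻¹ ^ 2 • b, a]

/-- The factor in `cd * ab * cd = spinorNorm * cd`. -/
def spinorNorm (s : ℂˣ) (k : ℂ) : ℂ :=
  -((1 + qParam s ^ 2) * k) * ((1 + (qParam s)⁻¹ ^ 2) * k)

namespace CliffordRelations

variable {s : ℂˣ} {k : ℂ} {a b c d : C} (h : CliffordRelations s k a b c d)
include h

/-- The relations in right-associated form, so that rewriting also reaches an unordered pair at the
head of a longer word. -/
theorem reorder (z : C) :
    a * (a * z) = 0 ∧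
    b * (a * z) = (-qParam s ^ 2 • (a * b) - qHat s • (a * c)) * z ∧
    b * (b * z) = -qHat s • (a * d) * z ∧
    c * (a * z) = -(a * c) * z ∧
    c * (b * z) = (-(b * c) - (1 - (qParam s)⁻¹ ^ 2) • (a * d) +
      ((1 + (qParam s)⁻¹ ^ 2) * k) • 1) * z ∧
    c * (c * z) = 0 ∧
    d * (a * z) = (-(a * d) - ((1 + qParam s ^ 2) * k) • 1) * z ∧
    d * (b * z) = (-qParam s ^ 2 • (b * d) - qHat s • (c * d)) * z ∧
    d * (c * z) = -(c * d) * z ∧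
    d * (d * z) = 0 := by
  simp only [← mul_assoc, h.aa, h.ba, h.bb, h.ca, h.cb, h.cc, h.da, h.db, h.dc, h.dd, zero_mul,
    and_self]

theorem mul_spinor (j : Fin 4) :
    a * spinor a b c d j = ∑ l, gamma s k (0, 0) l j • spinor a b c d l ∧
    b * spinor a b c d j = ∑ l, gamma s k (0, 1) l j • spinor a b c d l ∧
    c * spinor a b c d j = ∑ l, gamma s k (1, 0) l j • spinor a b c d l ∧
    d * spinor a b c d j = ∑ l, gamma s k (1, 1) l j • spinor a b c d l := by
  fin_cases j <;> refine ⟨?_, ?_, ?_, ?_⟩ <;>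
    simp [spinor, gamma, Fin.sum_univ_four, h.dd, h.reorder, add_mul, sub_mul, mul_add, mul_assoc] <;> try module

/-- Every spinor is a left multiple of the vacuum cd, so it suffices to reduce cd · C_j · S_l, which
is a multiple of cd. The coefficient -q⁻² in the third cospinor compensates ba · cd = -q² ab · cd.
-/
theorem spinor_mul_cospinor_mul_spinor (i j l : Fin 4) :
    spinor a b c d i * cospinor s a b j * spinor a b c d l =
      if j = l then spinorNorm s k • spinor a b c d i else 0 := by
  have hs : (s : ℂ) ≠ 0 := s.ne_zero
  have key : c * d * (cospinor s a b j * spinor a b c d l) =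
      if j = l then spinorNorm s k • (c * d) else 0 := by
    fin_cases j <;> fin_cases l <;>
    simp [spinor, cospinor, spinorNorm, h.dd, h.reorder, add_mul, sub_mul, mul_add, mul_assoc] <;> try (match_scalars; field_simp; try ring)
  have h1 : ∃ x, spinor a b c d i = x * (c * d) := by
    fin_cases i
    · exact ⟨a * b, by simp [spinor, mul_assoc]⟩
    · exact ⟨1, by simp [spinor]⟩
    · exact ⟨a, by simp [spinor]⟩
    · exact ⟨b, by simp [spinor]⟩
  obtain ⟨x, hx⟩ := h1
  rw [mul_assoc, hx, mul_assoc, key]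
  split_ifs <;> simp

/-- Completeness of the matrix units: after ordering, all words of positive length cancel. This is
what makes the spinors generate the whole algebra, not just a corner. -/
theorem sum_spinor_mul_cospinor :
    ∑ j, spinor a b c d j * cospinor s a b j = spinorNorm s k • 1 := by
  have hs : (s : ℂ) ≠ 0 := s.ne_zero
  simp [Fin.sum_univ_four, spinor, cospinor, spinorNorm, h.cb, h.da, h.db, h.reorder, add_mul, sub_mul,
    mul_add, mul_sub, mul_assoc]
  match_scalars <;> field_simp <;> ring

end CliffordRelations

end Relations

/-! ### The ten relations in the Clifford algebra of the calculus. -/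

section

variable {s : ℂˣ} {ν : ℤˣ} {g : (Idx × Idx → OSL s) →ₗ[OSL s] OSL s} {k : ℂ}

theorem sum_smul_θ (hg : ∀ p, g (Pi.single p 1) = algebraMap ℂ (OSL s) (metricEntry s k p))
    (w : Idx × Idx → ℂ) (hw : IsSymmetric fun p => algebraMap ℂ (OSL s) (w p)) :
    ∑ p, w p • (Clifford.θ (calcHom s ν) (calcBraiding s ν) g p.1 *
      Clifford.θ (calcHom s ν) (calcBraiding s ν) g p.2) =
        (∑ p, w p * metricEntry s k p) • 1 :=
  Clifford.quadratic_relation w (mem_ker_calcBraiding.2 hw) _ hg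

theorem cliffordRelations
    (hg : ∀ p, g (Pi.single p 1) = algebraMap ℂ (OSL s) (metricEntry s k p)) :
    CliffordRelations s k (θ₁₁ g : Cl s ν g) (θ₁₂ g) (θ₂₁ g) (θ₂₂ g) := by
  have hs : (s : ℂ) ≠ 0 := s.ne_zero
  have key := sum_smul_θ (ν := ν) hg
  -- Each test vector has a 1 at one non-increasing pair of indices and 0 at the other such pairs;
  -- the six symmetry equations force its remaining coordinates.
  have haa := key (fun p => if p = ((0, 0), (0, 0)) then 1 else 0) (by simp [IsSymmetric])
  have hba := key (fun p => if p = ((0, 1), (0, 0)) then 1 else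
    if p = ((0, 0), (0, 1)) then qParam s ^ 2 else if p = ((0, 0), (1, 0)) then qHat s else 0)
    (by simp [IsSymmetric, Algebra.algebraMap_eq_smul_one])
  have hbb := key (fun p => if p = ((0, 1), (0, 1)) then 1 else
    if p = ((0, 0), (1, 1)) then qHat s else 0)
    (by simp [IsSymmetric, Algebra.algebraMap_eq_smul_one])
  have hca := key (fun p => if p = ((1, 0), (0, 0)) then 1 else
    if p = ((0, 0), (1, 0)) then 1 else 0) (by simp [IsSymmetric])
  have hcb := key (fun p => if p = ((1, 0), (0, 1)) then 1 else
    if p = ((0, 1), (1, 0)) then 1 else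
      if p = ((0, 0), (1, 1)) then 1 - (qParam s)⁻¹ ^ 2 else 0)
    (by simp [IsSymmetric, Algebra.algebraMap_eq_smul_one, sub_smul])
  have hcc := key (fun p => if p = ((1, 0), (1, 0)) then 1 else 0) (by simp [IsSymmetric])
  have hda := key (fun p => if p = ((1, 1), (0, 0)) then 1 else
    if p = ((0, 0), (1, 1)) then 1 else 0) (by simp [IsSymmetric])
  have hdb := key (fun p => if p = ((1, 1), (0, 1)) then 1 else
    if p = ((0, 1), (1, 1)) then qParam s ^ 2 else if p = ((1, 0), (1, 1)) then qHat s else 0)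
    (by simp [IsSymmetric, Algebra.algebraMap_eq_smul_one])
  have hdc := key (fun p => if p = ((1, 1), (1, 0)) then 1 else
    if p = ((1, 0), (1, 1)) then 1 else 0) (by simp [IsSymmetric])
  have hdd := key (fun p => if p = ((1, 1), (1, 1)) then 1 else 0) (by simp [IsSymmetric])
  clear key
  simp [Fintype.sum_prod_type, Fin.sum_univ_two, metricEntry, Chat, Ccheck, RhatInv]
    at haa hba hbb hca hcb hcc hda hdb hdc hdd
  constructor
  · exact haa
  · linear_combination (norm := skip) hba
    simp only [θ₁₁, θ₁₂, θ₂₁]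
    match_scalars <;> field_simp <;> ring
  · linear_combination (norm := skip) hbb
    simp only [θ₁₁, θ₁₂, θ₂₂]
    match_scalars <;> field_simp <;> ring
  · exact eq_neg_of_add_eq_zero_right hca
  · linear_combination (norm := skip) hcb
    simp only [θ₁₁, θ₁₂, θ₂₁, θ₂₂]
    match_scalars <;> field_simp <;> ring
  · exact hcc
  · linear_combination (norm := skip) hda
    simp only [θ₁₁, θ₂₂]
    match_scalars <;> field_simp <;> ring
  · linear_combination (norm := skip) hdb
    simp only [θ₁₂, θ₂₁, θ₂₂]
    match_scalars <;> field_simp <;> ring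
  · exact eq_neg_of_add_eq_zero_right hdc
  · exact hdd

end

/-! ### The spinor representation on a free A-module. -/

section Representation

variable {A : Type} [Ring A] [Bialgebra ℂ A] {I : Type} [Fintype I] [DecidableEq I]
variable {K : Type} [Fintype K]

/-- The operator of a one-form on the free left module `K → A`, for complex matrices `γ`. -/
def formOperator (f : A →ₐ[ℂ] Matrix I I ℂ) (γ : I → Matrix K K ℂ) (i : I) :
    Module.End ℂ (K → A) :=
  LinearMap.pi fun k => ∑ j, ∑ l, γ j k l • (move f i j ∘ₗ LinearMap.proj l)

theorem formOperator_apply (f : A →ₐ[ℂ] Matrix I I ℂ) (γ : I → Matrix K K ℂ) (i : I) (x : K → A)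
    (k : K) : formOperator f γ i x k = ∑ j, ∑ l, γ j k l • move f i j (x l) := by
  simp [formOperator]

/-- Moving two one-forms past x_l is right multiplication by x_l on Γ ⊗ Γ. The quadratic relation
for z is thereby reduced to a matrix identity for the tensors z · x_l. -/
theorem sum_mul_formOperator_sq (f : A →ₐ[ℂ] Matrix I I ℂ) (γ : I → Matrix K K ℂ)
    (z : I × I → A) (x : K → A) (k : K) :
    ∑ p, z p * formOperator f γ p.1 (formOperator f γ p.2 x) k =
      ∑ l, ∑ r : I × I, (γ r.1 * γ r.2) k l • rmul₂ f z (x l) r := by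
  have key : ∀ p : I × I, z p * formOperator f γ p.1 (formOperator f γ p.2 x) k =
      ∑ l, ∑ r : I × I,
        (γ r.1 * γ r.2) k l • (z p * move f p.1 r.1 (move f p.2 r.2 (x l))) := by
    intro p
    simp only [formOperator_apply, Matrix.mul_apply, map_sum, map_smul, Finset.mul_sum,
      Finset.smul_sum, Finset.sum_smul, mul_smul_comm, smul_smul, Fintype.sum_prod_type]
    refine (Finset.sum_congr rfl fun j _ => ?_).trans Finset.sum_comm
    refine (Finset.sum_congr rfl fun m _ => Finset.sum_comm).trans ?_
    refine Finset.sum_comm.trans (Finset.sum_congr rfl fun l _ => Finset.sum_comm)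
  simp only [key, rmul₂, Finset.smul_sum]
  exact Finset.sum_comm.trans (Finset.sum_congr rfl fun l _ => Finset.sum_comm)

variable [DecidableEq K]

/-- The spinor representation of the Clifford algebra. -/
def spinorRep {f : A →ₐ[ℂ] Matrix I I ℂ} {σ : (I × I → A) →ₗ[A] (I × I → A)}
    {g : (I × I → A) →ₗ[A] A} (γ : I → Matrix K K ℂ)
    (hσ : ∀ z ∈ LinearMap.ker (LinearMap.id - σ), ∀ a,
      rmul₂ f z a ∈ LinearMap.ker (LinearMap.id - σ))
    (hg : ∀ z a, g (rmul₂ f z a) = g z * a)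
    (hγ : ∀ z ∈ LinearMap.ker (LinearMap.id - σ), ∀ k l,
      ∑ r : I × I, (γ r.1 * γ r.2) k l • z r = if k = l then g z else 0) :
    Clifford f σ g →ₐ[ℂ] Module.End ℂ (K → A) :=
  Clifford.lift (Algebra.lsmul ℂ ℂ (K → A)) (formOperator f γ)
    (by
      intro i a
      refine LinearMap.ext fun x => funext fun k => ?_
      simp only [Module.End.mul_apply, LinearMap.sum_apply, Finset.sum_apply, Algebra.lsmul_coe,
        Pi.smul_apply, smul_eq_mul, formOperator_apply, move_mul, Finset.mul_sum, Finset.smul_sum,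
        mul_smul_comm]
      exact (Finset.sum_congr rfl fun j _ => Finset.sum_comm).trans Finset.sum_comm)
    (by
      intro z hz
      refine LinearMap.ext fun x => funext fun k => ?_
      simp only [Module.End.mul_apply, LinearMap.sum_apply, Finset.sum_apply, Algebra.lsmul_coe,
        Pi.smul_apply, smul_eq_mul]
      rw [sum_mul_formOperator_sq]
      -- The tensor z · x_l is again fixed by σ, so the matrix identity applies and gives g(z · x_l)
      -- = g(z) x_l.
      simp only [hγ _ (hσ z hz _), hg]
      simp)

end Representation

section

variable {s : ℂˣ} {ν : ℤˣ} {g : (Idx × Idx → OSL s) →ₗ[OSL s] OSL s} {c : ℂ}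

/-- The γ-matrices satisfy the Clifford relations: eliminating the six dependent coordinates leaves
an identity in the ten free ones. -/
theorem sum_gamma_smul
    (hg : ∀ p, g (Pi.single p 1) = algebraMap ℂ (OSL s) (metricEntry s c p))
    {z : Idx × Idx → OSL s} (hz : IsSymmetric z) (k l : Fin 4) :
    ∑ r : Idx × Idx, (gamma s c r.1 * gamma s c r.2) k l • z r = if k = l then g z else 0 := by
  have hs : (s : ℂ) ≠ 0 := s.ne_zero
  have h : g z = ∑ r : Idx × Idx, metricEntry s c r • z r := by
    rw [apply_eq_sum_single]
    refine Finset.sum_congr rfl fun p _ => ?_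
    rw [hg, Algebra.smul_def, Algebra.commutes]
  obtain ⟨h1, h2, h3, h4, h5, h6⟩ := hz
  rw [h]
  fin_cases k <;> fin_cases l <;>
    simp [Fintype.sum_prod_type, Fin.sum_univ_two, Matrix.mul_apply, Fin.sum_univ_four, gamma,
      metricEntry, Chat, Ccheck, RhatInv, h1, h2, h3, h4, h5, h6] <;>
    try (match_scalars <;> field_simp <;> try ring)

theorem nontrivial_Cl (hcalc : IsCalcMetric s ν g)
    (hg : ∀ p, g (Pi.single p 1) = algebraMap ℂ (OSL s) (metricEntry s c p)) :
    Nontrivial (Cl s ν g) :=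
  (spinorRep (gamma s c)
    (fun _ hz a => mem_ker_calcBraiding.2 ((mem_ker_calcBraiding.1 hz).rmul₂ a))
    hcalc.map_rmul₂
    (fun _ hz => sum_gamma_smul hg (mem_ker_calcBraiding.1 hz)) :
      Cl s ν g →ₐ[ℂ] Module.End ℂ (Fin 4 → OSL s)).toRingHom.domain_nontrivial

end

/-! ### Matrix units in Cl and the classification of covariant ideals. -/

section

variable {s : ℂˣ} {ν : ℤˣ} {g : (Idx × Idx → OSL s) →ₗ[OSL s] OSL s} {c : ℂ}

variable (g) in
/-- The spinors in the Clifford algebra. -/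
def clSpinor : Fin 4 → Cl s ν g := spinor (θ₁₁ g) (θ₁₂ g) (θ₂₁ g) (θ₂₂ g)

variable (g) in
/-- The elements of the Clifford algebra dual to the spinors. -/
def clCospinor (c : ℂ) (j : Fin 4) : Cl s ν g :=
  (spinorNorm s c)⁻¹ • cospinor s (θ₁₁ g) (θ₁₂ g) j

theorem θ_mul_clSpinor
    (hg : ∀ p, g (Pi.single p 1) = algebraMap ℂ (OSL s) (metricEntry s c p)) (i : Idx)
    (j : Fin 4) :
    Clifford.θ (calcHom s ν) (calcBraiding s ν) g i * clSpinor g j =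
      ∑ l, gamma s c i l j • clSpinor g l := by
  have h := (cliffordRelations (ν := ν) hg).mul_spinor j
  obtain ⟨i₁, i₂⟩ := i
  fin_cases i₁ <;> fin_cases i₂
  · exact h.1
  · exact h.2.1
  · exact h.2.2.1
  · exact h.2.2.2

variable (ν) in
/-- The left ideal `∑ l, A * clSpinor l`. -/
def spinorIdeal (hg : ∀ p, g (Pi.single p 1) = algebraMap ℂ (OSL s) (metricEntry s c p)) :
    Ideal (Cl s ν g) :=
  let T : Submodule ℂ (Cl s ν g) := LinearMap.range
    (∑ l, LinearMap.mulRight ℂ (clSpinor g l) ∘ₗ (clA g).toLinearMap ∘ₗ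
      (LinearMap.proj l : (Fin 4 → OSL s) →ₗ[ℂ] OSL s))
  { T.toAddSubmonoid with
    smul_mem' := by
      have hT : ∀ t, t ∈ T ↔ ∃ a : Fin 4 → OSL s, t = ∑ l, clA g (a l) * clSpinor g l := by
        intro t
        simp [T, eq_comm]
      have hmem : ∀ a l, clA g a * clSpinor g l ∈ T := by
        intro a l
        refine (hT _).2 ⟨Pi.single l a, ?_⟩
        rw [Finset.sum_eq_single l]
        · simp
        · intro m _ hm
          simp [Pi.single_eq_of_ne hm]
        · simp
      intro x t ht
      refine Clifford.mul_mem_of_generators T ?_ ?_ x ht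
      · intro a t ht
        obtain ⟨b, rfl⟩ := (hT t).1 ht
        rw [Finset.mul_sum]
        refine T.sum_mem fun l _ => ?_
        have := hmem (a * b l) l
        rwa [map_mul, mul_assoc] at this
      · intro i t ht
        obtain ⟨b, rfl⟩ := (hT t).1 ht
        rw [Finset.mul_sum]
        refine T.sum_mem fun l _ => ?_
        -- The one-form is first moved past the coefficient, then acts on the spinor through γ.
        rw [← mul_assoc, clA, Clifford.θ_mul_ofA, Finset.sum_mul]
        refine T.sum_mem fun j _ => ?_
        rw [mul_assoc, θ_mul_clSpinor hg, Finset.mul_sum]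
        refine T.sum_mem fun m _ => ?_
        rw [mul_smul_comm]
        exact T.smul_mem _ (hmem _ m) }

theorem mem_spinorIdeal
    (hg : ∀ p, g (Pi.single p 1) = algebraMap ℂ (OSL s) (metricEntry s c p)) {x : Cl s ν g} :
    x ∈ spinorIdeal ν hg ↔ ∃ a : Fin 4 → OSL s, x = ∑ l, clA g (a l) * clSpinor g l := by
  change x ∈ LinearMap.range
    (∑ l, LinearMap.mulRight ℂ (clSpinor g l) ∘ₗ (clA g).toLinearMap ∘ₗ
      (LinearMap.proj l : (Fin 4 → OSL s) →ₗ[ℂ] OSL s)) ↔ _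
  simp [eq_comm]

theorem clSpinor_mem_spinorIdeal
    (hg : ∀ p, g (Pi.single p 1) = algebraMap ℂ (OSL s) (metricEntry s c p)) (j : Fin 4) :
    clSpinor g j ∈ spinorIdeal ν hg := by
  refine (mem_spinorIdeal hg).2 ⟨Pi.single j 1, ?_⟩
  rw [Finset.sum_eq_single j]
  · simp
  · intro m _ hm
    simp [Pi.single_eq_of_ne hm]
  · simp

section

variable (hg : ∀ p, g (Pi.single p 1) = algebraMap ℂ (OSL s) (metricEntry s c p))
  (hc : spinorNorm s c ≠ 0)
include hg hc

theorem clSpinor_mul_clCospinor_mul_clSpinor (i j l : Fin 4) :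
    (clSpinor g i : Cl s ν g) * clCospinor g c j * clSpinor g l =
      if j = l then clSpinor g i else 0 := by
  have h := (cliffordRelations (ν := ν) hg).spinor_mul_cospinor_mul_spinor i j l
  rw [clCospinor, mul_smul_comm, smul_mul_assoc, clSpinor, h]
  split_ifs
  · rw [smul_smul, inv_mul_cancel₀ hc, one_smul]
  · rw [smul_zero]

theorem sum_clSpinor_mul_clCospinor :
    ∑ j, (clSpinor g j : Cl s ν g) * clCospinor g c j = 1 := by
  have h := (cliffordRelations (ν := ν) hg).sum_spinor_mul_cospinor
  simp only [clCospinor, mul_smul_comm, ← Finset.smul_sum, clSpinor, h]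
  rw [smul_smul, inv_mul_cancel₀ hc, one_smul]

/-- Write x = ∑ (x S_j) C_j by completeness and expand each x S_j in the left ideal ∑ A S_l. -/
theorem exists_eq_sum_clSpinor_mul_clCospinor (x : Cl s ν g) :
    ∃ a : Fin 4 × Fin 4 → OSL s,
      x = ∑ p, clA g (a p) * (clSpinor g p.1 * clCospinor g c p.2) := by
  have h : ∀ j, ∃ a : Fin 4 → OSL s, x * clSpinor g j = ∑ l, clA g (a l) * clSpinor g l :=
    fun j => (mem_spinorIdeal hg).1
      ((spinorIdeal ν hg).mul_mem_left x (clSpinor_mem_spinorIdeal hg j))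
  choose a ha using h
  refine ⟨fun p => a p.2 p.1, ?_⟩
  rw [Fintype.sum_prod_type_right]
  simp only [← mul_assoc, ← Finset.sum_mul, ← ha]
  simp only [mul_assoc, ← Finset.mul_sum, sum_clSpinor_mul_clCospinor hg hc, mul_one]

end

section

variable (hcalc : IsCalcMetric s ν g)

/-- The coinvariants of the left coaction. -/
abbrev clCoinvariants : Subalgebra ℂ (Cl s ν g) :=
  Clifford.coinvariants (braiding_leftCovariant (calcHom s ν) (calcCoaction s))
    hcalc.left_covariant

theorem clSpinor_mem_coinvariants (j : Fin 4) : clSpinor g j ∈ clCoinvariants hcalc := by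
  have h : ∀ i, Clifford.θ (calcHom s ν) (calcBraiding s ν) g i ∈ clCoinvariants hcalc :=
    fun i => Clifford.θ_mem_coinvariants i
  have hcd := mul_mem (h (1, 0)) (h (1, 1))
  fin_cases j
  · exact mul_mem (h (0, 0)) (mul_mem (h (0, 1)) hcd)
  · exact hcd
  · exact mul_mem (h (0, 0)) hcd
  · exact mul_mem (h (0, 1)) hcd

theorem clCospinor_mem_coinvariants (j : Fin 4) : clCospinor g c j ∈ clCoinvariants hcalc := by
  have h : ∀ i, Clifford.θ (calcHom s ν) (calcBraiding s ν) g i ∈ clCoinvariants hcalc :=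
    fun i => Clifford.θ_mem_coinvariants i
  refine Subalgebra.smul_mem _ ?_ _
  fin_cases j
  · exact one_mem _
  · exact mul_mem (h (0, 0)) (h (0, 1))
  · exact Subalgebra.smul_mem _ (h (0, 1)) _
  · exact h (0, 0)

/-- The projection to the coinvariants. -/
abbrev clProj : Cl s ν g →ₗ[ℂ] Cl s ν g :=
  Clifford.proj (braiding_leftCovariant (calcHom s ν) (calcCoaction s)) hcalc.left_covariant
    OSL.antipode

theorem clProj_clA_mul (a : OSL s) {w : Cl s ν g} (hw : w ∈ clCoinvariants hcalc) :
    clProj hcalc (clA g a * w) = Coalgebra.counit (R := ℂ) a • w :=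
  Clifford.proj_ofA_mul OSL.mul_antipode_rTensor_comul a hw

variable (hg : ∀ p, g (Pi.single p 1) = algebraMap ℂ (OSL s) (metricEntry s c p))
  (hc : spinorNorm s c ≠ 0)
include hg hc

theorem exists_clProj_ne_zero {J : Ideal (Cl s ν g)}
    (hJ : IsCovariantLeftIdeal (clCoaction hcalc) J) (hJ0 : J ≠ ⊥) :
    ∃ y ∈ J, clProj hcalc y ∈ J ∧ clProj hcalc y ≠ 0 :=
  Clifford.exists_proj_ne_zero OSL.mul_antipode_rTensor_comul
    (fun p : Fin 4 × Fin 4 => mul_mem (clSpinor_mem_coinvariants hcalc p.1)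
      (clCospinor_mem_coinvariants (c := c) hcalc p.2))
    (exists_eq_sum_clSpinor_mul_clCospinor hg hc) hJ hJ0

/-- The projection provides a nonzero element of J that is a complex matrix; as in the simplicity of
a full matrix algebra, sandwiching it yields all diagonal matrix units, whose sum is 1. -/
theorem isSimpleCovariant_clCoaction : IsSimpleCovariant (clCoaction hcalc) := by
  refine ⟨nontrivial_Cl hcalc hg, fun J hJ2 hJ => or_iff_not_imp_left.2 fun hJ0 => ?_⟩
  obtain ⟨y, -, hyJ, hy0⟩ := exists_clProj_ne_zero hcalc hg hc hJ hJ0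
  obtain ⟨a, rfl⟩ := exists_eq_sum_clSpinor_mul_clCospinor hg hc y
  have hP : clProj hcalc (∑ p, clA g (a p) * (clSpinor g p.1 * clCospinor g c p.2)) =
      ∑ p, Coalgebra.counit (R := ℂ) (a p) • (clSpinor g p.1 * clCospinor g c p.2) := by
    rw [map_sum]
    exact Finset.sum_congr rfl fun p _ => clProj_clA_mul hcalc _
      (mul_mem (clSpinor_mem_coinvariants hcalc p.1) (clCospinor_mem_coinvariants hcalc p.2))
  rw [hP] at hyJ hy0
  obtain ⟨⟨k, l⟩, -, hkl⟩ := Finset.exists_ne_zero_of_sum_ne_zero hy0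
  have hkl0 : Coalgebra.counit (R := ℂ) (a (k, l)) ≠ 0 := fun h => hkl (by rw [h, zero_smul])
  -- Multiplication by E_{jk} on the left and E_{lj} on the right isolates the (k, l) coefficient,
  -- where E_{ij} = S_i C_j. Linear independence of the E_{ij} is not needed.
  have hsand : ∀ j, (clSpinor g j : Cl s ν g) * clCospinor g c k *
      (∑ p, Coalgebra.counit (R := ℂ) (a p) • (clSpinor g p.1 * clCospinor g c p.2)) *
        (clSpinor g l * clCospinor g c j) =
      Coalgebra.counit (R := ℂ) (a (k, l)) • (clSpinor g j * clCospinor g c j) := by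
    intro j
    rw [Finset.mul_sum, Finset.sum_mul, Finset.sum_eq_single (k, l)]
    · rw [mul_smul_comm, smul_mul_assoc, ← mul_assoc, ← mul_assoc,
        clSpinor_mul_clCospinor_mul_clSpinor hg hc, if_pos rfl,
        clSpinor_mul_clCospinor_mul_clSpinor hg hc, if_pos rfl]
    · rintro ⟨k', l'⟩ _ hne
      rw [mul_smul_comm, smul_mul_assoc, ← mul_assoc, ← mul_assoc,
        clSpinor_mul_clCospinor_mul_clSpinor hg hc]
      by_cases hk : k = k'
      · have hl : l' ≠ l := fun hl => hne (by rw [hk, hl])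
        rw [if_pos hk, clSpinor_mul_clCospinor_mul_clSpinor hg hc, if_neg hl, zero_mul, smul_zero]
      · rw [if_neg hk, zero_mul, zero_mul, zero_mul, smul_zero]
    · simp
  have hmem : ∀ j, (clSpinor g j : Cl s ν g) * clCospinor g c j ∈ J := by
    intro j
    have h := J.mul_mem_left (algebraMap ℂ (Cl s ν g) (Coalgebra.counit (R := ℂ) (a (k, l)))⁻¹)
      (hJ2.mul_mem_of_left (clSpinor g l * clCospinor g c j)
        (J.mul_mem_left (clSpinor g j * clCospinor g c k) hyJ))
    rwa [hsand, ← Algebra.smul_def, smul_smul, inv_mul_cancel₀ hkl0, one_smul] at h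
  rw [Ideal.eq_top_iff_one, ← sum_clSpinor_mul_clCospinor (ν := ν) hg hc]
  exact J.sum_mem fun j _ => hmem j

/-- A nonzero covariant left ideal inside ∑ A S_l contains a nonzero complex combination of spinors,
and S_j C_k turns that into a nonzero multiple of any chosen S_j. -/
theorem isMinimalCovariantLeftIdeal_spinorIdeal :
    IsMinimalCovariantLeftIdeal (clCoaction hcalc) (spinorIdeal ν hg) := by
  refine ⟨⟨?_, ?_⟩, ?_⟩
  · intro x hx
    obtain ⟨a, rfl⟩ := (mem_spinorIdeal hg).1 hx
    rw [map_sum]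
    refine Submodule.sum_mem _ fun l _ => ?_
    have h := Clifford.coaction_ofA_mul (a l) (clSpinor_mem_coinvariants hcalc l)
    change clCoaction hcalc (clA g (a l) * clSpinor g l) = _ at h
    rw [h]
    generalize Coalgebra.comul (R := ℂ) (a l) = t
    induction t with
    | zero => simp
    | add x y hx hy => rw [map_add]; exact Submodule.add_mem _ hx hy
    | tmul x y =>
      refine ⟨x ⊗ₜ[ℂ] ⟨clA g y * clSpinor g l, (spinorIdeal ν hg).mul_mem_left _
        (clSpinor_mem_spinorIdeal hg l)⟩, ?_⟩
      simp [clA]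
  · intro h0
    have : Nontrivial (Cl s ν g) := nontrivial_Cl hcalc hg
    refine one_ne_zero (α := Cl s ν g) ?_
    rw [← sum_clSpinor_mul_clCospinor (ν := ν) hg hc]
    refine Finset.sum_eq_zero fun j _ => ?_
    have h := clSpinor_mem_spinorIdeal (ν := ν) hg j
    rw [h0, Ideal.mem_bot] at h
    rw [h, zero_mul]
  · rintro J ⟨hJ, hJ0⟩ hle x hx
    obtain ⟨y, hy, hyJ, hy0⟩ := exists_clProj_ne_zero hcalc hg hc hJ hJ0
    obtain ⟨a, rfl⟩ := (mem_spinorIdeal hg).1 (hle hy)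
    have hP : clProj hcalc (∑ l, clA g (a l) * clSpinor g l) =
        ∑ l, Coalgebra.counit (R := ℂ) (a l) • clSpinor g l := by
      rw [map_sum]
      exact Finset.sum_congr rfl fun l _ =>
        clProj_clA_mul hcalc _ (clSpinor_mem_coinvariants hcalc l)
    rw [hP] at hyJ hy0
    obtain ⟨k, -, hk⟩ := Finset.exists_ne_zero_of_sum_ne_zero hy0
    have hk0 : Coalgebra.counit (R := ℂ) (a k) ≠ 0 := fun h => hk (by rw [h, zero_smul])
    have hmem : ∀ j, (clSpinor g j : Cl s ν g) ∈ J := by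
      intro j
      have h := J.mul_mem_left (algebraMap ℂ (Cl s ν g) (Coalgebra.counit (R := ℂ) (a k))⁻¹)
        (J.mul_mem_left (clSpinor g j * clCospinor g c k) hyJ)
      simpa [Finset.mul_sum, clSpinor_mul_clCospinor_mul_clSpinor hg hc, ← Algebra.smul_def,
        smul_smul, hk0] using h
    obtain ⟨b, rfl⟩ := (mem_spinorIdeal hg).1 hx
    exact J.sum_mem fun l _ => J.mul_mem_left _ (hmem l)

end

/-- The coefficients of the generators of `S₀` with respect to the spinors. -/
def spinorCoeff (s : ℂˣ) (c : ℂ) : Fin 4 → ℂ :=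
  ![qParam s / ((qParam s + (qParam s)⁻¹) * c), 1, 1, qParam s]

theorem S₀_generators_eq :
    ψp₁ g c = spinorCoeff s c 0 • (clSpinor g 0 : Cl s ν g) ∧
    ψp₂ g = spinorCoeff s c 1 • (clSpinor g 1 : Cl s ν g) ∧
    ψm₁ g = spinorCoeff s c 2 • (clSpinor g 2 : Cl s ν g) ∧
    ψm₂ g = spinorCoeff s c 3 • (clSpinor g 3 : Cl s ν g) := by
  simp [ψp₁, ψp₂, ψm₁, ψm₂, spinorCoeff, clSpinor, spinor, mul_assoc]

theorem S₀_eq_spinorIdeal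
    (hg : ∀ p, g (Pi.single p 1) = algebraMap ℂ (OSL s) (metricEntry s c p))
    (hc : ∀ j, spinorCoeff s c j ≠ 0) : (S₀ g c : Ideal (Cl s ν g)) = spinorIdeal ν hg := by
  obtain ⟨h0, h1, h2, h3⟩ := S₀_generators_eq (ν := ν) (g := g) (c := c)
  have hsmul : ∀ (J : Ideal (Cl s ν g)) (r : ℂ) {x : Cl s ν g}, x ∈ J → r • x ∈ J := by
    intro J r x hx
    rw [Algebra.smul_def]
    exact J.mul_mem_left _ hx
  rw [S₀, h0, h1, h2, h3]
  apply le_antisymm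
  · rw [Ideal.span_le]
    have h := fun j => hsmul _ (spinorCoeff s c j) (clSpinor_mem_spinorIdeal (ν := ν) hg j)
    rintro x (rfl | rfl | rfl | rfl)
    exacts [h 0, h 1, h 2, h 3]
  · intro x hx
    obtain ⟨a, rfl⟩ := (mem_spinorIdeal hg).1 hx
    refine Ideal.sum_mem _ fun j _ => Ideal.mul_mem_left _ _ ?_
    have h := hsmul (Ideal.span {spinorCoeff s c 0 • (clSpinor g 0 : Cl s ν g),
      spinorCoeff s c 1 • clSpinor g 1, spinorCoeff s c 2 • clSpinor g 2,
      spinorCoeff s c 3 • clSpinor g 3}) (spinorCoeff s c j)⁻¹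
      (x := spinorCoeff s c j • clSpinor g j)
      (Ideal.subset_span (by fin_cases j <;> simp))
    rwa [smul_smul, inv_mul_cancel₀ (hc j), one_smul] at h

end

end

end QuantumClifford

/-! ### Assembly: the constants are nonzero because q is not a root of unity. -/

theorem mainTheorem7 (s : ℂˣ) (hq : ∀ n : ℕ, 0 < n → qParam s ^ n ≠ 1) (ν : ℤˣ)
    (g : (Idx × Idx → OSL s) →ₗ[OSL s] OSL s) (hg : IsCalcMetric s ν g) :
    ∃ c₁ : ℂ, c₁ ≠ 0 ∧
      (∀ i j k l : Fin 2, g (Pi.single ((i, j), (k, l)) 1) =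
        algebraMap ℂ (OSL s)
          (-(s : ℂ) * c₁ * ∑ m, ∑ n, Chat s i m * Chat s n l * RhatInv s m n j k)) ∧
      IsSimpleCovariant (clCoaction hg) ∧
      IsMinimalCovariantLeftIdeal (clCoaction hg) (S₀ g c₁) ∧
      (∀ x : Cl s ν g, x ∈ S₀ g c₁ ↔ ∃ a₁ a₂ b₁ b₂ : OSL s,
        x = clA g a₁ * ψp₁ g c₁ + clA g a₂ * ψp₂ g + clA g b₁ * ψm₁ g + clA g b₂ * ψm₂ g) := by
  obtain ⟨c, hc⟩ := hg.eq_metricEntry (by simpa using hq 1 one_pos) (hq 2 two_pos)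
  have hq0 : qParam s ≠ 0 := pow_ne_zero 2 s.ne_zero
  have hc0 : c ≠ 0 := by
    rintro rfl
    refine hg.ne_zero (LinearMap.ext fun z => ?_)
    rw [apply_eq_sum_single]
    simp [hc, metricEntry]
  -- The factor 1 + q² divides q⁴ - 1.
  have hq2 : 1 + qParam s ^ 2 ≠ 0 := fun h =>
    hq 4 (by norm_num) (by linear_combination (qParam s ^ 2 - 1) * h)
  have hq2' : 1 + (qParam s)⁻¹ ^ 2 ≠ 0 := by
    have h : 1 + (qParam s)⁻¹ ^ 2 = (1 + qParam s ^ 2) * (qParam s)⁻¹ ^ 2 := by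
      field_simp; ring
    rw [h]
    exact mul_ne_zero hq2 (pow_ne_zero 2 (inv_ne_zero hq0))
  have hq2'' : qParam s + (qParam s)⁻¹ ≠ 0 := by
    have h : qParam s + (qParam s)⁻¹ = (1 + qParam s ^ 2) * (qParam s)⁻¹ := by
      field_simp; ring
    rw [h]
    exact mul_ne_zero hq2 (inv_ne_zero hq0)
  have hnorm : spinorNorm s c ≠ 0 :=
    mul_ne_zero (neg_ne_zero.2 (mul_ne_zero hq2 hc0)) (mul_ne_zero hq2' hc0)
  have hcoeff : ∀ j, spinorCoeff s c j ≠ 0 := by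
    intro j
    fin_cases j
    · exact div_ne_zero hq0 (mul_ne_zero hq2'' hc0)
    · exact one_ne_zero
    · exact one_ne_zero
    · exact hq0
  have hS : (S₀ g c : Ideal (Cl s ν g)) = spinorIdeal ν hc := S₀_eq_spinorIdeal hc hcoeff
  refine ⟨c, hc0, fun i j k l => hc _, isSimpleCovariant_clCoaction hg hc hnorm,
    hS ▸ isMinimalCovariantLeftIdeal_spinorIdeal hg hc hnorm, fun x => ?_⟩
  obtain ⟨h0, h1, h2, h3⟩ := S₀_generators_eq (ν := ν) (g := g) (c := c)
  rw [hS, mem_spinorIdeal, h0, h1, h2, h3]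
  constructor
  · rintro ⟨a, rfl⟩
    refine ⟨(spinorCoeff s c 0)⁻¹ • a 0, (spinorCoeff s c 1)⁻¹ • a 1,
      (spinorCoeff s c 2)⁻¹ • a 2, (spinorCoeff s c 3)⁻¹ • a 3, ?_⟩
    simp only [Fin.sum_univ_four, map_smul, smul_mul_smul_comm, inv_mul_cancel₀ (hcoeff _),
      one_smul]
  · rintro ⟨a₁, a₂, b₁, b₂, rfl⟩
    refine ⟨fun j => spinorCoeff s c j • ![a₁, a₂, b₁, b₂] j, ?_⟩
    simp [Fin.sum_univ_four]
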